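/- Let $\mathfrak g=\mathfrak g_1\oplus\mathfrak g_2$ be a finite-dimensional complex Lie algebra that is the direct sum of two semisimple ideals, and let $\mathfrak h$ be a Cartan subalgebra of $\mathfrak g$. Two subalgebras $\mathfrak s,\mathfrak t$ of a complex Lie algebra $\mathfrak l$ are called linearly equivalent if for every finite-dimensional representation $\rho:\mathfrak l\to\mathfrak{gl}(V)$ the subalgebras $\rho(\mathfrak s)$ and $\rho(\mathfrak t)$ are conjugate under $\mathrm{GL}(V)$. A canonical generating set of a semisimple Lie algebra $\mathfrak m$ of rank $n$ consists of elements $h_i,x_i,y_i$ ($1\le i\le n$) generating $\mathfrak m$ such that $[h_i,h_j]=0$, $[x_i,y_j]=\delta_{ij}h_i$, $[h_j,x_i]=C(i,j)x_i$, $[h_j,y_i]=-C(i,j)y_i$, where $C$ is the Cartan matrix of the root system of $\mathfrak m$ (in some ordering of the simple roots); $(h_1,\dots,h_n)$ is its $h$-part. The zero algebra is considered semisimple. For $k=1,2$ let $L_k$ be a set of representatives of the linear equivalence classes (with respect to $\mathfrak g_k$) of the semisimple subalgebras of $\mathfrak g_k$, such that each element of $L_k$ has a canonical generating set with $h$-part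 lying in $\mathfrak h$. For all $M_1=\mathfrak a\oplus\mathfrak b_1$ in $L_1$ and $M_2=\mathfrak b_2\oplus\mathfrak c$ in $L_2$, decomposed as direct sums of (possibly zero) ideals with $\mathfrak b_1\cong\mathfrak b_2$, choose canonical generating sets with $h$-parts in $\mathfrak h$: $h^1_i,x^1_i,y^1_i$ ($1\le i\le s$) of $\mathfrak a$; $h^1_{s+i},x^1_{s+i},y^1_{s+i}$ ($1\le i\le r$) of $\mathfrak b_1$; $h^2_i,x^2_i,y^2_i$ ($1\le i\le r$) of $\mathfrak b_2$; $h^2_{r+i},x^2_{r+i},y^2_{r+i}$ ($1\le i\le m$) of $\mathfrak c$, in such a way that $h^1_{s+i}\mapsto h^2_i$, $x^1_{s+i}\mapsto x^2_i$, $y^1_{s+i}\mapsto y^2_i$ ($1\le i\le r$) defines an isomorphism $\mathfrak b_1\to\mathfrak b_2$. For each permutation $\pi$ of $\{1,\dots,r\}$ preserving the Cartan matrix $C$ of $\mathfrak b_2$, i.e. $C(\pi(i),\pi(j))=C(i,j)$ for all $i,j$, form the subalgebra of $\mathfrak g$ generated by $$\{h^1_i,x^1_i,y^1_i\mid 1\le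 i\le s\}\cup\{h^1_{s+i}+h^2_{\pi(i)},\,x^1_{s+i}+x^2_{\pi(i)},\,y^1_{s+i}+y^2_{\pi(i)}\mid 1\le i\le r\}\cup\{h^2_i,x^2_i,y^2_i\mid r+1\le i\le r+m\}.$$ Let $L$ be the set of all subalgebras of $\mathfrak g$ obtained in this way from all such $M_1,M_2$, decompositions and permutations $\pi$, using the chosen generating sets. Then, for any such choices, every semisimple subalgebra of $\mathfrak g$ is linearly equivalent (with respect to $\mathfrak g$) to an algebra in $L$. -/

import Mathlib

universe u

namespace SemisimpleSubalgebras

section LinearEquivalence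

attribute [local instance] LieRing.ofAssociativeRing

/-- Two subalgebras of a complex Lie algebra `L` are linearly equivalent if their images under every
finite-dimensional representation `ρ : L → gl(V)` are conjugate under `GL(V)`. (Every
finite-dimensional complex vector space is isomorphic to one in the universe of `L`.) -/
def LinearlyEquivalent {L : Type u} [LieRing L] [LieAlgebra ℂ L] (S T : LieSubalgebra ℂ L) : Prop :=
  ∀ (V : Type u) [AddCommGroup V] [Module ℂ V] [FiniteDimensional ℂ V]
    (ρ : L →ₗ⁅ℂ⁆ Module.End ℂ V),
    ∃ a : V ≃ₗ[ℂ] V, (S.map ρ).map (a.lieConj : Module.End ℂ V →ₗ⁅ℂ⁆ Module.End ℂ V) = T.map ρ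

end LinearEquivalence

/-- `R` is a set of representatives of the linear equivalence classes of semisimple subalgebras
of `L` (the zero subalgebra is one of these). -/
structure IsSetOfRepresentatives {L : Type u} [LieRing L] [LieAlgebra ℂ L]
    (R : Set (LieSubalgebra ℂ L)) : Prop where
  semisimple : ∀ M ∈ R, LieAlgebra.IsSemisimple ℂ M
  existsUnique : ∀ S : LieSubalgebra ℂ L, LieAlgebra.IsSemisimple ℂ S →
    ∃! M, M ∈ R ∧ LinearlyEquivalent S M

/-- The subalgebra `M` is the direct sum of its ideals `S` and `T`. -/
structure IsDirectSum {L : Type u} [LieRing L] [LieAlgebra ℂ L]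
    (S T M : LieSubalgebra ℂ L) : Prop where
  sup_eq : S.toSubmodule ⊔ T.toSubmodule = M.toSubmodule
  disjoint : Disjoint S.toSubmodule T.toSubmodule
  lie_eq_zero : ∀ x ∈ S, ∀ y ∈ T, ⁅x, y⁆ = 0

/-- A canonical generating set `h i, x i, y i` (`i : Fin n`) of a subalgebra `M` of `L`: generators
satisfying the Chevalley relations with respect to the Cartan matrix of `M`. This is
`LieAlgebra.Basis`, which records also the Cartan subalgebra of `M` spanned by the `h i`. -/
structure CanonicalGenerators {L : Type u} [LieRing L] [LieAlgebra ℂ L]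
    (n : ℕ) (M : LieSubalgebra ℂ L) where
  cartan : LieSubalgebra ℂ M
  basis : LieAlgebra.Basis (Fin n) cartan

namespace CanonicalGenerators

variable {L : Type u} [LieRing L] [LieAlgebra ℂ L] {n : ℕ} {M : LieSubalgebra ℂ L}

/-- The elements `h i`, in the ambient Lie algebra. -/
def h (G : CanonicalGenerators n M) (i : Fin n) : L := (G.basis.h i : L)

/-- The elements `x i`, in the ambient Lie algebra. -/
def x (G : CanonicalGenerators n M) (i : Fin n) : L := (G.basis.e i : L)

/-- The elements `y i`, in the ambient Lie algebra. -/
def y (G : CanonicalGenerators n M) (i : Fin n) : L := (G.basis.f i : L)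

/-- The Cartan matrix. -/
def cartanMatrix (G : CanonicalGenerators n M) : Matrix (Fin n) (Fin n) ℤ := G.basis.A

end CanonicalGenerators

section Gluing

variable {g : Type u} [LieRing g] [LieAlgebra ℂ g]

/-- The `h`-part of a canonical generating set of a subalgebra of the ideal `I` lies in `H`. -/
def HPartIn (H : LieSubalgebra ℂ g) {I : LieIdeal ℂ g} {n : ℕ} {M : LieSubalgebra ℂ I}
    (G : CanonicalGenerators n M) : Prop :=
  ∀ i, (G.h i : g) ∈ H

variable {I₁ I₂ : LieIdeal ℂ g}

/-- Elements `M₁ = a ⊕ b₁` of `R₁` and `M₂ = b₂ ⊕ c` of `R₂`, where `b₁` and `b₂` are isomorphic. -/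
structure GluablePair (R₁ : Set (LieSubalgebra ℂ I₁)) (R₂ : Set (LieSubalgebra ℂ I₂)) where
  M₁ : LieSubalgebra ℂ I₁
  M₂ : LieSubalgebra ℂ I₂
  mem₁ : M₁ ∈ R₁
  mem₂ : M₂ ∈ R₂
  a : LieSubalgebra ℂ I₁
  b₁ : LieSubalgebra ℂ I₁
  b₂ : LieSubalgebra ℂ I₂
  c : LieSubalgebra ℂ I₂
  decomp₁ : IsDirectSum a b₁ M₁
  decomp₂ : IsDirectSum b₂ c M₂
  iso : Nonempty (b₁ ≃ₗ⁅ℂ⁆ b₂)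

/-- Canonical generating sets of `a`, `b₁`, `b₂`, `c` with `h`-parts in `H`, where those of `b₁` and
`b₂` are in the same order: sending the one to the other defines an isomorphism `b₁ → b₂`. -/
structure GluingGenerators (H : LieSubalgebra ℂ g) {R₁ : Set (LieSubalgebra ℂ I₁)}
    {R₂ : Set (LieSubalgebra ℂ I₂)} (P : GluablePair R₁ R₂) where
  s : ℕ
  r : ℕ
  m : ℕ
  genA : CanonicalGenerators s P.a
  genB₁ : CanonicalGenerators r P.b₁
  genB₂ : CanonicalGenerators r P.b₂
  genC : CanonicalGenerators m P.c
  hPart_a : HPartIn H genA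
  hPart_b₁ : HPartIn H genB₁
  hPart_b₂ : HPartIn H genB₂
  hPart_c : HPartIn H genC
  sameOrder : ∃ φ : P.b₁ ≃ₗ⁅ℂ⁆ P.b₂, ∀ i,
    φ (genB₁.basis.h i) = genB₂.basis.h i ∧
    φ (genB₁.basis.e i) = genB₂.basis.e i ∧
    φ (genB₁.basis.f i) = genB₂.basis.f i

namespace GluingGenerators

variable {H : LieSubalgebra ℂ g} {R₁ : Set (LieSubalgebra ℂ I₁)} {R₂ : Set (LieSubalgebra ℂ I₂)}
  {P : GluablePair R₁ R₂}

/-- The permutation `π` preserves the Cartan matrix of `b₂`. -/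
def PreservesCartanMatrix (D : GluingGenerators H P) (π : Equiv.Perm (Fin D.r)) : Prop :=
  ∀ i j, D.genB₂.cartanMatrix (π i) (π j) = D.genB₂.cartanMatrix i j

/-- The subalgebra of `g` generated by the generators of `a`, the sums of the generators of `b₁` and
the `π`-permuted generators of `b₂`, and the generators of `c`. -/
def glued (D : GluingGenerators H P) (π : Equiv.Perm (Fin D.r)) : LieSubalgebra ℂ g :=
  LieSubalgebra.lieSpan ℂ g
    ({z | ∃ i, z = (D.genA.h i : g) ∨ z = (D.genA.x i : g) ∨ z = (D.genA.y i : g)} ∪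
     {z | ∃ i, z = (D.genB₁.h i : g) + (D.genB₂.h (π i) : g) ∨
               z = (D.genB₁.x i : g) + (D.genB₂.x (π i) : g) ∨
               z = (D.genB₁.y i : g) + (D.genB₂.y (π i) : g)} ∪
     {z | ∃ i, z = (D.genC.h i : g) ∨ z = (D.genC.x i : g) ∨ z = (D.genC.y i : g)})

end GluingGenerators

/-- The set of all subalgebras constructed by gluing, given a choice `D` of canonical generating
sets for every gluable pair. -/
def constructedSubalgebras {H : LieSubalgebra ℂ g} {R₁ : Set (LieSubalgebra ℂ I₁)}
    {R₂ : Set (LieSubalgebra ℂ I₂)} (D : ∀ P : GluablePair R₁ R₂, GluingGenerators H P) :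
    Set (LieSubalgebra ℂ g) :=
  {T | ∃ (P : GluablePair R₁ R₂) (π : Equiv.Perm (Fin (D P).r)),
    (D P).PreservesCartanMatrix π ∧ T = (D P).glued π}

end Gluing

end SemisimpleSubalgebras

/-! Let `f₁, f₂` be the projections of a semisimple subalgebra `S` to the two ideals. Suppose `f_k`
can be replaced by a homomorphism `α_k` onto the representative of the class of `f_k(S)`, without
changing any representation of the ideal up to isomorphism (`exists_hom_range_mem`). An intertwiner
for one ideal may be chosen to commute with the commutant of that ideal, in particular with the
other ideal, so both replacements can be made at once (`repIso_add`). Now `S = ker α₂ ⊕ kb ⊕ ker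
α₁`. The outer summands give `a` and `c`, while `kb` embeds diagonally in `b₁ ⊕ b₂`. This diagonal
differs from the prescribed isomorphism `b₁ → b₂` by an automorphism of `b₂`, the product of a
permutation of the canonical generators, which is the `π` of the construction, and of a quasi-inner
automorphism, which no representation detects.

Two facts carry this. First, linear equivalence provides an isomorphism of subalgebras that may
depend on the representation; `exists_equiv_repIso` finds one that serves all. Up to quasi-inner
automorphisms there are finitely many candidates; a faithful representation admitting the fewest is
compared with any other `σ` by adding `σ` to more than `dim σ` copies of it, multiplicities being
recovered by division with remainder.

Second, `exists_isQuasiInner_mul_perm` factors automorphisms: conjugacy of Cartan subalgebras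
(`engelConj_of_isRegular`), simple reflections and a rescaling by `exp (ad z)` reduce an
automorphism to a permutation of the generators. Complete reducibility
(`exists_isCompl_lieSubmodule`) underlies the comparison of representations. -/

/-! ### Whitehead's first lemma and Weyl's theorem. -/

namespace LieAlgebra.IsKilling

open LieModule Module

variable {K L : Type*} [Field K] [CharZero K] [LieRing L] [LieAlgebra K L]

/-- The derived ideal of an ideal on which the trace form of a representation vanishes acts
nilpotently. -/
lemma isNilpotent_lie_of_traceForm_eq_zero {U : Type*} [AddCommGroup U] [Module K U]
    [LieRingModule L U] [LieModule K L U] [FiniteDimensional K U] (I : LieIdeal K L)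
    (hI : ∀ x ∈ I, ∀ y ∈ I, traceForm K L U x y = 0) :
    LieModule.IsNilpotent (⁅I, I⁆ : LieIdeal K L) U := by
  have h0 : traceForm K I U = 0 := by
    ext x y
    exact hI x x.2 y y.2
  have h1 := isNilpotent_derivedSeries_of_traceForm_eq_zero h0
  rw [isNilpotent_iff_forall' (R := K)] at h1 ⊢
  rintro ⟨x, hx⟩
  refine h1 ⟨⟨x, LieSubmodule.lie_le_left I I hx⟩, ?_⟩
  rw [LieIdeal.derivedSeries_eq_derivedSeriesOfIdeal_comap, LieIdeal.mem_comap]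
  exact hx

-- If `⁅D, ⊤⁆` is not zero it is everything; then the lower central series of `D` on `U` is
-- constant, yet reaches zero, so `U` itself is zero.
omit [CharZero K] in
lemma lie_top_eq_bot_of_isNilpotent {U : Type*} [AddCommGroup U] [Module K U]
    [LieRingModule L U] [LieModule K L U]
    (hU : ∀ N : LieSubmodule K L U, N = ⊥ ∨ N = ⊤) (D : LieIdeal K L)
    (hD : LieModule.IsNilpotent D U) : ⁅D, (⊤ : LieSubmodule K L U)⁆ = ⊥ := by
  refine (hU _).elim id fun h ↦ ?_
  obtain ⟨k, hk⟩ := (LieModule.isNilpotent_iff K D U).mp hD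
  have key : ∀ k, D.lcs U k = ⊤ := by
    intro k
    induction k with
    | zero => simp
    | succ k ih => rw [LieIdeal.lcs_succ, ih, h]
  have h2 : (D.lcs U k : Submodule K U) = ⊥ := by
    rw [LieIdeal.coe_lcs_eq, hk]; rfl
  rw [key k] at h2
  have h3 : (⊤ : LieSubmodule K L U) = ⊥ := by
    rw [← LieSubmodule.toSubmodule_inj]; simpa using h2
  rw [h, h3]

variable [FiniteDimensional K L] [IsKilling K L]

lemma eq_zero_of_forall_lie_eq_zero (K : Type*) {L : Type*} [Field K] [LieRing L]
    [LieAlgebra K L] [FiniteDimensional K L] [IsKilling K L] {x : L}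
    (hx : ∀ y : L, ⁅x, y⁆ = 0) : x = 0 := by
  have h : x ∈ LieAlgebra.center K L := by
    rw [LieModule.mem_maxTrivSubmodule]
    intro y; rw [← lie_skew, hx, neg_zero]
  simpa using h

omit [CharZero K] in
/-- A Lie algebra with nondegenerate Killing form is perfect. -/
lemma lie_top_top_eq_top : (⁅(⊤ : LieIdeal K L), (⊤ : LieIdeal K L)⁆ : LieIdeal K L) = ⊤ := by
  set D : LieIdeal K L := ⁅(⊤ : LieIdeal K L), (⊤ : LieIdeal K L)⁆
  have h : D.killingCompl = ⊥ := by
    rw [eq_bot_iff]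
    intro x hx
    rw [LieIdeal.mem_killingCompl] at hx
    refine (LieSubmodule.mem_bot x).mpr (eq_zero_of_forall_lie_eq_zero K fun y ↦ ?_)
    have : ⁅x, y⁆ ∈ LinearMap.ker (killingForm K L) := by
      refine LinearMap.mem_ker.mpr (LinearMap.ext fun z ↦ ?_)
      rw [LieModule.traceForm_apply_lie_apply, LieModule.traceForm_comm]
      exact hx _ (LieSubmodule.lie_mem_lie (LieSubmodule.mem_top y) (LieSubmodule.mem_top z))
    simpa using this
  have := (LieIdeal.isCompl_killingCompl D).sup_eq_top
  rwa [h, sup_bot_eq] at this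

/-- The trace form of an irreducible representation is nondegenerate on any ideal that meets the
kernel trivially. -/
lemma eq_zero_of_traceForm_eq_zero {U : Type*} [AddCommGroup U] [Module K U]
    [LieRingModule L U] [LieModule K L U] [FiniteDimensional K U]
    (hU : ∀ N : LieSubmodule K L U, N = ⊥ ∨ N = ⊤) (J : LieIdeal K L)
    (hJ : Disjoint J (LieModule.ker K L U)) {x : L} (hx : x ∈ J)
    (h : ∀ y ∈ J, traceForm K L U x y = 0) : x = 0 := by
  -- The radical of the trace form on `J`. By Cartan's criterion its derived ideal acts nilpotently,
  -- hence trivially, on `U`, so it lies in `J ⊓ ker = ⊥`. Thus `N` is abelian, hence zero.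
  let N : LieIdeal K L :=
    { carrier := {x | x ∈ J ∧ ∀ y ∈ J, traceForm K L U x y = 0}
      add_mem' := fun {a b} ha hb ↦ ⟨add_mem ha.1 hb.1, fun y hy ↦ by
        simp [ha.2 y hy, hb.2 y hy]⟩
      zero_mem' := ⟨J.zero_mem, by simp⟩
      smul_mem' := fun c a ha ↦ ⟨J.smul_mem c ha.1, fun y hy ↦ by simp [ha.2 y hy]⟩
      lie_mem := fun {z a} ha ↦ ⟨J.lie_mem ha.1, fun y hy ↦ by
        rw [LieModule.traceForm_apply_lie_apply', ha.2 _ (J.lie_mem hy), neg_zero]⟩ }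
  have hNJ : N ≤ J := fun y hy ↦ hy.1
  have h1 := lie_top_eq_bot_of_isNilpotent hU ⁅N, N⁆
    (isNilpotent_lie_of_traceForm_eq_zero N fun x hx y hy ↦ hx.2 y hy.1)
  have h2 : (⁅N, N⁆ : LieIdeal K L) ≤ LieModule.ker K L U := by
    intro y hy
    rw [LieModule.mem_ker]
    intro m
    have := LieSubmodule.lie_mem_lie hy (LieSubmodule.mem_top (R := K) (L := L) m)
    rw [h1] at this
    simpa using this
  have h3 : (⁅N, N⁆ : LieIdeal K L) = ⊥ :=
    le_bot_iff.mp (hJ (LieSubmodule.lie_le_left N N |>.trans hNJ) h2)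
  have h4 : IsLieAbelian N := (LieSubmodule.lie_abelian_iff_lie_self_eq_bot N).mpr h3
  have h5 := ideal_eq_bot_of_isLieAbelian (R := K) N
  have : x ∈ N := ⟨hx, h⟩
  rw [h5] at this
  simpa using this

/-- The first cohomology of an irreducible representation vanishes. -/
lemma exists_eq_lie_of_isIrreducible {U : Type*} [AddCommGroup U] [Module K U]
    [LieRingModule L U] [LieModule K L U] [FiniteDimensional K U]
    (hU : ∀ N : LieSubmodule K L U, N = ⊥ ∨ N = ⊤) (c : L →ₗ[K] U)
    (hc : ∀ x y, c ⁅x, y⁆ = ⁅x, c y⁆ - ⁅y, c x⁆) : ∃ u, ∀ x, c x = ⁅x, u⁆ := by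
  classical
  by_cases hA : LieModule.ker K L U = ⊤
  · have h0 : ∀ (x : L) (u : U), ⁅x, u⁆ = 0 := fun x u ↦
      (LieModule.mem_ker K L U x).mp (hA ▸ LieSubmodule.mem_top x) u
    refine ⟨0, fun x ↦ ?_⟩
    have hx : x ∈ ((⁅(⊤ : LieIdeal K L), (⊤ : LieIdeal K L)⁆ : LieIdeal K L)).toSubmodule := by
      rw [lie_top_top_eq_top]; trivial
    rw [LieSubmodule.lieIdeal_oper_eq_linear_span'] at hx
    rw [lie_zero, ← LinearMap.mem_ker]
    refine Submodule.span_le.mpr ?_ hx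
    rintro _ ⟨y, -, z, -, rfl⟩
    simp [hc, h0]
  -- The trace form is nondegenerate on `J`. The Casimir operator `Γ` of dual bases of `J` commutes
  -- with `L` and has trace `dim J ≠ 0`, so it is invertible. The vector sought is `Γ⁻¹ ∑ bᵢ ·
  -- c(b'ᵢ)`.
  · set J := (LieModule.ker K L U).killingCompl with hJ
    have hcompl : IsCompl (LieModule.ker K L U) J := LieIdeal.isCompl_killingCompl _
    have hnd : ∀ x ∈ J, (∀ y ∈ J, traceForm K L U x y = 0) → x = 0 := fun x hx h ↦
      eq_zero_of_traceForm_eq_zero hU J hcompl.disjoint.symm hx h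
    let β : LinearMap.BilinForm K J := traceForm K J U
    have hβs : β.IsSymm := ⟨fun x y ↦ LieModule.traceForm_comm K J U x y⟩
    have hβ : β.Nondegenerate := by
      refine hβs.isRefl.nondegenerate_iff_separatingLeft.mpr ?_
      intro x hx
      exact Subtype.ext (hnd x x.2 fun y hy ↦ hx ⟨y, hy⟩)
    let b := Module.finBasis K J
    let b' := β.dualBasis hβ b
    have hb' : ∀ i j, β (b' i) (b j) = if j = i then 1 else 0 :=
      LinearMap.BilinForm.apply_dualBasis_left hβ b
    have hb : ∀ i j, β (b i) (b' j) = if i = j then 1 else 0 :=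
      LinearMap.BilinForm.apply_dualBasis_right hβ hβs b
    have exp1 : ∀ y : J, y = ∑ j, β (b' j) y • b j := fun y ↦ by
      conv_lhs => rw [← b.sum_repr y]
      refine Finset.sum_congr rfl fun j _ ↦ ?_
      congr 1
      conv_rhs => rw [← b.sum_repr y]
      simp [-Basis.sum_repr, hb']
    have exp2 : ∀ y : J, y = ∑ j, β (b j) y • b' j := fun y ↦ by
      conv_lhs => rw [← b'.sum_repr y]
      refine Finset.sum_congr rfl fun j _ ↦ ?_
      congr 1
      conv_rhs => rw [← b'.sum_repr y]
      simp [-Basis.sum_repr, hb]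
    have hinv : ∀ (x : L) (i j), β (b' j) ⁅x, b i⁆ = -β (b i) ⁅x, b' j⁆ := fun x i j ↦ by
      change traceForm K L U (b' j) ⁅x, (b i : L)⁆ = -traceForm K L U (b i) ⁅x, (b' j : L)⁆
      rw [LieModule.traceForm_comm K L U (b i), LieModule.traceForm_apply_lie_apply', neg_neg]
    -- Invariance of `∑ bᵢ ⊗ b'ᵢ`. The choice `m(a, b) = a · (b · u)` shows that `Γ` commutes with
    -- `L`; the choice `m(a, b) = a · c(b)` solves the cocycle equation.
    have key : ∀ (m : J →ₗ[K] J →ₗ[K] U) (x : L),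
        ∑ i, (m ⁅x, b i⁆ (b' i) + m (b i) ⁅x, b' i⁆) = 0 := by
      intro m x
      rw [Finset.sum_add_distrib]
      have e1 : ∑ i, m ⁅x, b i⁆ (b' i) = ∑ i, ∑ j, β (b' j) ⁅x, b i⁆ • m (b j) (b' i) := by
        refine Finset.sum_congr rfl fun i _ ↦ ?_
        conv_lhs => rw [exp1 ⁅x, b i⁆]
        simp
      have e2 : ∑ i, m (b i) ⁅x, b' i⁆ = ∑ i, ∑ j, β (b j) ⁅x, b' i⁆ • m (b i) (b' j) := by
        refine Finset.sum_congr rfl fun i _ ↦ ?_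
        conv_lhs => rw [exp2 ⁅x, b' i⁆]
        simp
      rw [e1, e2, Finset.sum_comm, ← Finset.sum_add_distrib]
      refine Finset.sum_eq_zero fun i _ ↦ ?_
      rw [← Finset.sum_add_distrib]
      refine Finset.sum_eq_zero fun j _ ↦ ?_
      rw [hinv, neg_smul, neg_add_cancel]
    let act : J →ₗ[K] U →ₗ[K] U := (LieModule.toEnd K J U : J →ₗ[K] Module.End K U)
    let Γ : Module.End K U := ∑ i, toEnd K J U (b i) ∘ₗ toEnd K J U (b' i)
    have hΓ : ∀ u, Γ u = ∑ i, ⁅(b i : L), ⁅(b' i : L), u⁆⁆ := fun u ↦ by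
      simp [Γ, LinearMap.sum_apply]
    have hΓL : ∀ (x : L) (u : U), ⁅x, Γ u⁆ = Γ ⁅x, u⁆ := by
      intro x u
      have := key ((act.compl₂ (act.flip u))) x
      rw [hΓ, hΓ, lie_sum, ← sub_eq_zero, ← Finset.sum_sub_distrib, ← this]
      refine Finset.sum_congr rfl fun i _ ↦ ?_
      change _ = ⁅⁅x, (b i : L)⁆, ⁅(b' i : L), u⁆⁆ + ⁅(b i : L), ⁅⁅x, (b' i : L)⁆, u⁆⁆
      simp only [lie_lie, lie_sub]
      abel
    have htr : LinearMap.trace K U Γ = Module.finrank K J := by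
      have : ∀ i, LinearMap.trace K U (toEnd K J U (b i) ∘ₗ toEnd K J U (b' i)) = 1 := fun i ↦ by
        rw [← LieModule.traceForm_apply_apply]
        exact (hb i i).trans (if_pos rfl)
      simp [Γ, this]
    have hJ0 : Module.finrank K J ≠ 0 := by
      intro h0
      apply hA
      have : J = ⊥ := by
        rw [← LieSubmodule.toSubmodule_eq_bot]
        exact Submodule.finrank_eq_zero.mp h0
      have h1 := hcompl.sup_eq_top
      rwa [this, sup_bot_eq] at h1
    let Ker : LieSubmodule K L U :=
      { LinearMap.ker Γ with
        lie_mem := fun {x m} hm ↦ by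
          change Γ m = 0 at hm
          change Γ ⁅x, m⁆ = 0
          rw [← hΓL, hm, lie_zero] }
    have hinj : Function.Injective Γ := by
      rw [← LinearMap.ker_eq_bot]
      rcases hU Ker with h | h
      · exact (LieSubmodule.toSubmodule_eq_bot Ker).mpr h
      · exfalso
        have : Γ = 0 := LinearMap.ker_eq_top.mp ((LieSubmodule.toSubmodule_eq_top (N := Ker)).mpr h)
        rw [this, map_zero] at htr
        exact hJ0 (by exact_mod_cast htr.symm)
    obtain ⟨u, hu⟩ := (LinearMap.injective_iff_surjective.mp hinj)
      (∑ i, ⁅(b i : L), c (b' i)⁆)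
    refine ⟨u, fun x ↦ hinj ?_⟩
    rw [← hΓL, hu, hΓ, lie_sum, eq_comm, ← sub_eq_zero, ← Finset.sum_sub_distrib]
    rw [← key (act.compl₂ (c ∘ₗ (J : Submodule K L).subtype)) x]
    refine Finset.sum_congr rfl fun i _ ↦ ?_
    change _ = ⁅⁅x, (b i : L)⁆, c (b' i : L)⁆ + ⁅(b i : L), c ⁅x, (b' i : L)⁆⁆
    rw [hc]
    simp only [lie_lie, lie_sub]
    abel

/-- **Whitehead's first lemma**. -/
theorem exists_eq_lie_of_cocycle (n : ℕ) : ∀ {U : Type*} [AddCommGroup U] [Module K U]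
    [LieRingModule L U] [LieModule K L U] [FiniteDimensional K U], Module.finrank K U = n →
    ∀ (c : L →ₗ[K] U), (∀ x y, c ⁅x, y⁆ = ⁅x, c y⁆ - ⁅y, c x⁆) → ∃ u, ∀ x, c x = ⁅x, u⁆ := by
  induction n using Nat.strong_induction_on with
  | _ n ih =>
  intro U _ _ _ _ _ hn c hc
  by_cases hU : ∀ N : LieSubmodule K L U, N = ⊥ ∨ N = ⊤
  · exact exists_eq_lie_of_isIrreducible hU c hc
  push Not at hU
  obtain ⟨N, hN0, hN1⟩ := hU
  have d1 : Module.finrank K N < n := by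
    rw [← hn]
    exact Submodule.finrank_lt 
      (fun h ↦ hN1 ((LieSubmodule.toSubmodule_eq_top (N := N)).mp h))
  have d2 : Module.finrank K (U ⧸ N) < n := by
    have h1 := Submodule.finrank_quotient_add_finrank N.toSubmodule
    have h2 : 0 < Module.finrank K N.toSubmodule :=
      Module.finrank_pos_iff.mpr ((Submodule.nontrivial_iff_ne_bot).mpr
        (fun h ↦ hN0 ((LieSubmodule.toSubmodule_eq_bot N).mp h)))
    change Module.finrank K (U ⧸ N.toSubmodule) < n
    omega
  -- The cocycle is a coboundary modulo `N`; subtracting the coboundary of a lift leaves a cocycle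
  -- with values in `N`.
  obtain ⟨ubar, hubar⟩ := ih _ d2 rfl
    ((LieSubmodule.Quotient.mk' N : U →ₗ[K] U ⧸ N) ∘ₗ c) (fun x y ↦ by
      simp only [LinearMap.comp_apply, hc, map_sub]; rfl)
  obtain ⟨u0, rfl⟩ := LieSubmodule.Quotient.surjective_mk' N ubar
  have hmem : ∀ x, c x - ⁅x, u0⁆ ∈ N := fun x ↦ by
    have := hubar x
    rw [← LieSubmodule.mem_toSubmodule, ← Submodule.Quotient.mk_eq_zero, Submodule.Quotient.mk_sub,
      sub_eq_zero]
    exact this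
  let c' : L →ₗ[K] N := LinearMap.codRestrict N.toSubmodule
    (c - ((toEnd K L U : L →ₗ[K] Module.End K U).flip u0)) hmem
  obtain ⟨u1, hu1⟩ := ih _ d1 rfl c' (fun x y ↦ Subtype.ext (by
    change c ⁅x, y⁆ - ⁅⁅x, y⁆, u0⁆ = ⁅x, c y - ⁅y, u0⁆⁆ - ⁅y, c x - ⁅x, u0⁆⁆
    rw [hc, lie_lie, lie_sub, lie_sub]; abel))
  refine ⟨u0 + u1, fun x ↦ ?_⟩
  have : c x - ⁅x, u0⁆ = ⁅x, (u1 : U)⁆ := congrArg Subtype.val (hu1 x)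
  rw [lie_add, ← this, add_sub_cancel]

/-- **Weyl's theorem** on complete reducibility. -/
theorem exists_isCompl_lieSubmodule {V : Type*} [AddCommGroup V] [Module K V]
    [LieRingModule L V] [LieModule K L V] [FiniteDimensional K V] (W : LieSubmodule K L V) :
    ∃ W' : LieSubmodule K L V, IsCompl W.toSubmodule W'.toSubmodule := by
  obtain ⟨p, hp⟩ := LinearMap.exists_leftInverse_of_injective W.toSubmodule.subtype
    (Submodule.ker_subtype _)
  have hp' : ∀ w : W, p w = w := fun w ↦ LinearMap.congr_fun hp w
  let p₀ : V →ₗ[K] W := p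
  have hd : ∀ x : L, W.toSubmodule ≤ LinearMap.ker ⁅x, p₀⁆ := fun x w hw ↦ by
    have h1 := hp' ⟨w, hw⟩
    have h2 := hp' ⁅x, (⟨w, hw⟩ : W)⁆
    rw [LinearMap.mem_ker, LieHom.lie_apply, sub_eq_zero]
    exact (congrArg (fun u : W ↦ ⁅x, u⁆) h1).trans h2.symm
  -- The failure of the linear projection `p₀` to be equivariant vanishes on `W`, and so is a
  -- cocycle in `Hom(V/W, W)`. Subtracting a primitive `u` makes the projection equivariant; its
  -- kernel is the complement.
  let c : L →ₗ[K] ((V ⧸ W) →ₗ[K] W) :=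
    { toFun := fun x ↦ W.toSubmodule.liftQ ⁅x, p₀⁆ (hd x)
      map_add' := fun x y ↦ by
        refine Submodule.linearMap_qext _ (LinearMap.ext fun v ↦ ?_)
        change ⁅x + y, p₀⁆ v = ⁅x, p₀⁆ v + ⁅y, p₀⁆ v
        rw [add_lie]; rfl
      map_smul' := fun t x ↦ by
        refine Submodule.linearMap_qext _ (LinearMap.ext fun v ↦ ?_)
        change ⁅t • x, p₀⁆ v = t • ⁅x, p₀⁆ v
        rw [smul_lie]; rfl }
  have hc : ∀ (x : L) (v : V), c x (LieSubmodule.Quotient.mk v) = ⁅x, p₀⁆ v := fun x v ↦ rfl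
  obtain ⟨u, hu⟩ := exists_eq_lie_of_cocycle _ rfl c (fun x y ↦ by
    refine Submodule.linearMap_qext _ (LinearMap.ext fun v ↦ ?_)
    change ⁅⁅x, y⁆, p₀⁆ v = (⁅x, ⁅y, p₀⁆ v⁆ - ⁅y, p₀⁆ ⁅x, v⁆) - (⁅y, ⁅x, p₀⁆ v⁆ - ⁅x, p₀⁆ ⁅y, v⁆)
    rw [lie_lie]
    simp only [LinearMap.sub_apply, LieHom.lie_apply])
  let q : V →ₗ[K] W := p₀ - u ∘ₗ W.toSubmodule.mkQ
  have hq : ∀ w : W, q w = w := fun w ↦ by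
    have : W.toSubmodule.mkQ w = 0 := by simp
    change p w - u (W.toSubmodule.mkQ w) = w
    rw [this, map_zero, sub_zero, hp']
  have hqL : ∀ (x : L) (v : V), q ⁅x, v⁆ = ⁅x, q v⁆ := fun x v ↦ by
    have := hc x v
    rw [hu, LieHom.lie_apply, LieHom.lie_apply] at this
    change p₀ ⁅x, v⁆ - u ⁅x, LieSubmodule.Quotient.mk v⁆ =
      ⁅x, p₀ v - u (LieSubmodule.Quotient.mk v)⁆
    rw [lie_sub, sub_eq_sub_iff_add_eq_add]
    rw [sub_eq_sub_iff_add_eq_add] at this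
    rw [add_comm, this.symm, add_comm]
  refine ⟨{ LinearMap.ker q with
    lie_mem := fun {x m} hm ↦ by
      change q m = 0 at hm
      change q ⁅x, m⁆ = 0
      rw [hqL, hm, lie_zero] }, ?_⟩
  exact LinearMap.isCompl_of_proj hq

end LieAlgebra.IsKilling

/-! ### Exponentials of endomorphisms. -/

namespace Module.End

open scoped TensorProduct

variable {V W : Type*} [AddCommGroup V] [Module ℂ V] [FiniteDimensional ℂ V]
  [AddCommGroup W] [Module ℂ W] [FiniteDimensional ℂ W]

/-- Endomorphisms of a finite-dimensional complex vector space, as continuous endomorphisms of the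
space of coordinate vectors. -/
noncomputable def coordEquiv (V : Type*) [AddCommGroup V] [Module ℂ V] [FiniteDimensional ℂ V] :
    Module.End ℂ V ≃ₐ[ℂ] ((Fin (Module.finrank ℂ V) → ℂ) →L[ℂ] (Fin (Module.finrank ℂ V) → ℂ)) :=
  (LinearEquiv.conjAlgEquiv ℂ (Module.finBasis ℂ V).equivFun).trans
    (Module.End.toContinuousLinearMap _)

lemma coordEquiv_apply (f : Module.End ℂ V) (v : V) :
    coordEquiv V f ((Module.finBasis ℂ V).equivFun v) = (Module.finBasis ℂ V).equivFun (f v) := by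
  change (Module.finBasis ℂ V).equivFun
    (f ((Module.finBasis ℂ V).equivFun.symm ((Module.finBasis ℂ V).equivFun v))) = _
  rw [LinearEquiv.symm_apply_apply]

/-- The exponential of an endomorphism of a finite-dimensional complex vector space. -/
noncomputable def expEnd (f : Module.End ℂ V) : Module.End ℂ V :=
  (coordEquiv V).symm (NormedSpace.exp (coordEquiv V f))

lemma equivFun_expEnd (f : Module.End ℂ V) (v : V) :
    (Module.finBasis ℂ V).equivFun (expEnd f v) =
      NormedSpace.exp (coordEquiv V f) ((Module.finBasis ℂ V).equivFun v) := by
  rw [← coordEquiv_apply, expEnd, AlgEquiv.apply_symm_apply]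

lemma hasSum_expEnd (f : Module.End ℂ V) (v : V) :
    HasSum (fun n : ℕ ↦ (Module.finBasis ℂ V).equivFun ((n.factorial : ℂ)⁻¹ • (f ^ n) v))
      ((Module.finBasis ℂ V).equivFun (expEnd f v)) := by
  have h := NormedSpace.exp_series_hasSum_exp' (𝕂 := ℂ) (coordEquiv V f)
  have h2 := h.mapL (ContinuousLinearMap.apply ℂ _ ((Module.finBasis ℂ V).equivFun v))
  rw [equivFun_expEnd]
  have e : (fun n : ℕ ↦ (Module.finBasis ℂ V).equivFun ((n.factorial : ℂ)⁻¹ • (f ^ n) v)) =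
      fun n : ℕ ↦ ContinuousLinearMap.apply ℂ _ ((Module.finBasis ℂ V).equivFun v)
        ((n.factorial : ℂ)⁻¹ • coordEquiv V f ^ n) := funext fun n ↦ by
    rw [map_smul, ← coordEquiv_apply, map_pow]
    rfl
  rw [e]
  exact h2

/-- `T` intertwines all powers and is continuous in coordinates, so it carries one exponential
series to the other. This naturality controls exponentials on tensor products and on commutants. -/
lemma expEnd_apply_of_comm {f : Module.End ℂ V} {g : Module.End ℂ W} (T : V →ₗ[ℂ] W)
    (h : ∀ v, T (f v) = g (T v)) (v : V) : T (expEnd f v) = expEnd g (T v) := by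
  have hn : ∀ (n : ℕ) v, T ((f ^ n) v) = (g ^ n) (T v) := by
    intro n
    induction n with
    | zero => simp
    | succ n ih => intro v; rw [pow_succ, pow_succ, Module.End.mul_apply, ih, h]; rfl
  let T' := LinearMap.toContinuousLinearMap ((Module.finBasis ℂ W).equivFun.toLinearMap ∘ₗ T ∘ₗ
    (Module.finBasis ℂ V).equivFun.symm.toLinearMap)
  have hT' : ∀ v, T' ((Module.finBasis ℂ V).equivFun v) = (Module.finBasis ℂ W).equivFun (T v) :=
    fun v ↦ by
      change (Module.finBasis ℂ W).equivFun
        (T ((Module.finBasis ℂ V).equivFun.symm ((Module.finBasis ℂ V).equivFun v))) = _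
      rw [LinearEquiv.symm_apply_apply]
  have h1 := (hasSum_expEnd f v).mapL T'
  have h2 := hasSum_expEnd g (T v)
  simp only [hT', map_smul, hn] at h1 h2
  exact (Module.finBasis ℂ W).equivFun.injective (h1.unique h2)

lemma expEnd_zero : expEnd (0 : Module.End ℂ V) = 1 := by
  simp [expEnd]

lemma expEnd_add_of_commute {f g : Module.End ℂ V} (h : Commute f g) :
    expEnd (f + g) = expEnd f * expEnd g := by
  let _ : NormedAlgebra ℚ ((Fin (Module.finrank ℂ V) → ℂ) →L[ℂ] (Fin (Module.finrank ℂ V) → ℂ)) :=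
    NormedAlgebra.restrictScalars ℚ ℂ _
  rw [expEnd, map_add, NormedSpace.exp_add_of_commute (h.map (coordEquiv V)), map_mul]
  rfl

lemma expEnd_apply_of_eigen {f : Module.End ℂ V} {v : V} {c : ℂ} (h : f v = c • v) :
    expEnd f v = Complex.exp c • v := by
  have hn : ∀ n : ℕ, (f ^ n) v = c ^ n • v := by
    intro n
    induction n with
    | zero => simp
    | succ n ih => rw [pow_succ, Module.End.mul_apply, h, map_smul, ih, smul_smul, pow_succ']
  have h1 := hasSum_expEnd f v
  have h2 := (NormedSpace.exp_series_hasSum_exp' (𝕂 := ℂ) c).smul_const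
    ((Module.finBasis ℂ V).equivFun v)
  simp only [hn, map_smul, smul_smul] at h1
  refine (Module.finBasis ℂ V).equivFun.injective (h1.unique ?_)
  rw [map_smul, Complex.exp_eq_exp_ℂ]
  exact h2

lemma expEnd_apply_of_pow_three {f : Module.End ℂ V} {v : V} (h : f (f (f v)) = 0) :
    expEnd f v = v + f v + (2⁻¹ : ℂ) • f (f v) := by
  have h1 := hasSum_expEnd f v
  have h2 := hasSum_sum_of_ne_finset_zero (L := SummationFilter.unconditional ℕ)
    (f := fun n : ℕ ↦ (Module.finBasis ℂ V).equivFun ((n.factorial : ℂ)⁻¹ • (f ^ n) v))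
    (s := Finset.range 3) (fun n hn ↦ by
      obtain ⟨k, rfl⟩ := Nat.exists_eq_add_of_le (not_lt.mp (fun h ↦ hn (Finset.mem_range.mpr h)))
      have : (f ^ (3 + k)) v = 0 := by
        rw [add_comm, pow_add, Module.End.mul_apply]
        have : (f ^ 3) v = 0 := h
        rw [this, map_zero]
      simp [this])
  have h3 := h1.unique h2
  rw [← map_sum] at h3
  rw [(Module.finBasis ℂ V).equivFun.injective h3]
  simp [Finset.sum_range_succ, pow_succ]

end Module.End

/-! ### Automorphisms `exp (ad x)` and quasi-inner automorphisms. -/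

namespace LieAlgebra

open Module.End

section

attribute [local instance] LieRing.ofAssociativeRing

variable {M : Type*} [LieRing M] [LieAlgebra ℂ M] [FiniteDimensional ℂ M]
  {V : Type*} [AddCommGroup V] [Module ℂ V] [FiniteDimensional ℂ V]

-- The action map `M ⊗ V → V` intertwines `ad x ⊗ 1 + 1 ⊗ ρ x` with `ρ x`, and the exponential of a
-- sum of commuting operators is a product. For `ρ = ad` this says that `exp (ad x)` is an
-- automorphism.
open scoped TensorProduct in
lemma expEnd_rep (ρ : M →ₗ⁅ℂ⁆ Module.End ℂ V) (x y : M) (v : V) :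
    expEnd (ρ x) (ρ y v) = ρ (expEnd (LieAlgebra.ad ℂ M x) y) (expEnd (ρ x) v) := by
  let T : M ⊗[ℂ] V →ₗ[ℂ] V := TensorProduct.lift (ρ : M →ₗ[ℂ] Module.End ℂ V)
  let f₁ : Module.End ℂ (M ⊗[ℂ] V) := LinearMap.rTensor V (LieAlgebra.ad ℂ M x)
  let f₂ : Module.End ℂ (M ⊗[ℂ] V) := LinearMap.lTensor M (ρ x)
  have h12 : Commute f₁ f₂ := by
    refine TensorProduct.ext' fun y v ↦ ?_
    simp [f₁, f₂]
  have hT : ∀ t, T ((f₁ + f₂) t) = ρ x (T t) := by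
    intro t
    refine LinearMap.congr_fun (f := T ∘ₗ (f₁ + f₂)) (g := ρ x ∘ₗ T)
      (TensorProduct.ext' fun y v ↦ ?_) t
    simp [f₁, f₂, T, LieRing.of_associative_ring_bracket]
  have h1 := expEnd_apply_of_comm T hT (y ⊗ₜ v)
  rw [expEnd_add_of_commute h12, Module.End.mul_apply] at h1
  have h3 := expEnd_apply_of_comm (f := ρ x) (g := f₂) (TensorProduct.mk ℂ M V y)
    (fun w ↦ by simp [f₂]) v
  have h2 := expEnd_apply_of_comm (f := LieAlgebra.ad ℂ M x) (g := f₁)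
    ((TensorProduct.mk ℂ M V).flip (expEnd (ρ x) v)) (fun w ↦ by simp [f₁]) y
  simp only [LinearMap.flip_apply, TensorProduct.mk_apply] at h1 h2 h3
  rw [← h3, ← h2] at h1
  simpa [T] using h1.symm

lemma expEnd_neg_apply_expEnd (f : Module.End ℂ V) (v : V) : expEnd (-f) (expEnd f v) = v := by
  rw [← Module.End.mul_apply, ← expEnd_add_of_commute (Commute.neg_left (Commute.refl f)),
    neg_add_cancel, expEnd_zero, Module.End.one_apply]

/-- The automorphism `exp (ad x)`. -/
noncomputable def expAd (x : M) : M ≃ₗ⁅ℂ⁆ M :=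
  { expEnd (LieAlgebra.ad ℂ M x) with
    map_lie' := fun {y z} ↦ expEnd_rep (LieAlgebra.ad ℂ M) x y z
    invFun := expEnd (-LieAlgebra.ad ℂ M x)
    left_inv := fun y ↦ expEnd_neg_apply_expEnd _ y
    right_inv := fun y ↦ by
      have := expEnd_neg_apply_expEnd (-LieAlgebra.ad ℂ M x) y
      rwa [neg_neg] at this }

lemma expAd_apply (x y : M) : expAd x y = expEnd (LieAlgebra.ad ℂ M x) y := rfl

end

attribute [local instance] LieRing.ofAssociativeRing in
/-- An automorphism `q` is quasi-inner if, in every finite-dimensional representation, it is induced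
by an automorphism of the underlying vector space which commutes with the commutant of the
representation. -/
def IsQuasiInner {M : Type u} [LieRing M] [LieAlgebra ℂ M] (q : M ≃ₗ⁅ℂ⁆ M) : Prop :=
  ∀ (V : Type u) [AddCommGroup V] [Module ℂ V] [FiniteDimensional ℂ V]
    (ρ : M →ₗ⁅ℂ⁆ Module.End ℂ V), ∃ A : V ≃ₗ[ℂ] V,
      (∀ x v, A (ρ x v) = ρ (q x) (A v)) ∧
      ∀ B : Module.End ℂ V, (∀ x v, B (ρ x v) = ρ x (B v)) → ∀ v, A (B v) = B (A v)

namespace IsQuasiInner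

variable {M : Type u} [LieRing M] [LieAlgebra ℂ M]

lemma refl : IsQuasiInner (LieEquiv.refl : M ≃ₗ⁅ℂ⁆ M) :=
  fun V _ _ _ _ ↦ ⟨LinearEquiv.refl ℂ V, fun _ _ ↦ rfl, fun _ _ _ ↦ rfl⟩

lemma trans {q r : M ≃ₗ⁅ℂ⁆ M} (hq : IsQuasiInner q) (hr : IsQuasiInner r) :
    IsQuasiInner (q.trans r) := fun V _ _ _ ρ ↦ by
  obtain ⟨A, hA, hA'⟩ := hq V ρ
  obtain ⟨B, hB, hB'⟩ := hr V ρ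
  exact ⟨A.trans B, fun x v ↦ by simp [hA, hB],
    fun C hC v ↦ by simp [hA' C hC, hB' C hC]⟩

lemma symm {q : M ≃ₗ⁅ℂ⁆ M} (hq : IsQuasiInner q) : IsQuasiInner q.symm := fun V _ _ _ ρ ↦ by
  obtain ⟨A, hA, hA'⟩ := hq V ρ
  refine ⟨A.symm, fun x v ↦ A.injective ?_, fun C hC v ↦ A.injective ?_⟩
  · rw [A.apply_symm_apply, hA, q.apply_symm_apply, A.apply_symm_apply]
  · rw [A.apply_symm_apply, hA' C hC, A.apply_symm_apply]

lemma expAd [FiniteDimensional ℂ M] (x : M) : IsQuasiInner (LieAlgebra.expAd x) :=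
  fun V _ _ _ ρ ↦ by
    refine ⟨LinearEquiv.ofLinearMap (expEnd (ρ x)) (expEnd (-ρ x)) ?_ ?_, fun y v ↦ ?_,
      fun B hB v ↦ ?_⟩
    · refine LinearMap.ext fun v ↦ ?_
      have := expEnd_neg_apply_expEnd (-ρ x) v
      rwa [neg_neg] at this
    · exact LinearMap.ext fun v ↦ expEnd_neg_apply_expEnd (ρ x) v
    · exact expEnd_rep ρ x y v
    · exact (expEnd_apply_of_comm B (hB x) v).symm

end IsQuasiInner

end LieAlgebra

/-! ### Regular elements and conjugacy of Cartan subalgebras. -/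

namespace LieAlgebra

open Module.End LieSubalgebra Filter Topology

variable {M : Type u} [LieRing M] [LieAlgebra ℂ M] [FiniteDimensional ℂ M]

/-- Elements close to `x` are moved into the Engel subalgebra of `x` by some `exp (ad y)`. -/
lemma eventually_exists_expAd (x v : M) :
    ∀ᶠ z : ℂ in 𝓝 0, ∃ y, ∃ h ∈ engel ℂ x, expAd y h = x + z • v := by
  let e := (Module.finBasis ℂ M).equivFun
  let br : (Fin (Module.finrank ℂ M) → ℂ) →L[ℂ]
      ((Fin (Module.finrank ℂ M) → ℂ) →L[ℂ] (Fin (Module.finrank ℂ M) → ℂ)) :=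
    LinearMap.toContinuousLinearMap
      ((coordEquiv M).toLinearMap ∘ₗ (LieAlgebra.ad ℂ M : M →ₗ[ℂ] Module.End ℂ M) ∘ₗ
        e.symm.toLinearMap)
  have hbr : ∀ y, br (e y) = coordEquiv M (LieAlgebra.ad ℂ M y) := fun y ↦ by
    change coordEquiv M (LieAlgebra.ad ℂ M (e.symm (e y))) = _
    rw [e.symm_apply_apply]
  let E : Submodule ℂ (Fin (Module.finrank ℂ M) → ℂ) :=
    (engel ℂ x).toSubmodule.map e.toLinearMap
  let h₀ : E := ⟨e x, x, self_mem_engel ℂ x, rfl⟩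
  let F : (Fin (Module.finrank ℂ M) → ℂ) × E → (Fin (Module.finrank ℂ M) → ℂ) :=
    fun p ↦ NormedSpace.exp (br p.1) (p.2 : Fin (Module.finrank ℂ M) → ℂ)
  have hF0 : F (0, h₀) = e x := by simp [F, h₀]
  have d1 : HasStrictFDerivAt
      (fun p : (Fin (Module.finrank ℂ M) → ℂ) × E ↦ NormedSpace.exp (br p.1))
      (br ∘L ContinuousLinearMap.fst ℂ _ _) (0, h₀) := by
    have h1 : HasStrictFDerivAt (fun p : (Fin (Module.finrank ℂ M) → ℂ) × E ↦ br p.1)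
      (br ∘L ContinuousLinearMap.fst ℂ _ _) (0, h₀) :=
      br.hasStrictFDerivAt.comp (0, h₀) hasStrictFDerivAt_fst
    have h2 := hasStrictFDerivAt_exp_zero (𝕂 := ℂ)
      (𝔸 := (Fin (Module.finrank ℂ M) → ℂ) →L[ℂ] (Fin (Module.finrank ℂ M) → ℂ))
    have h3 := HasStrictFDerivAt.comp (0, h₀) (g := NormedSpace.exp) (by simpa using h2) h1
    exact h3
  have d2 : HasStrictFDerivAt
      (fun p : (Fin (Module.finrank ℂ M) → ℂ) × E ↦ (p.2 : Fin (Module.finrank ℂ M) → ℂ))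
      (E.subtypeL ∘L ContinuousLinearMap.snd ℂ _ _) (0, h₀) :=
    E.subtypeL.hasStrictFDerivAt.comp (0, h₀) hasStrictFDerivAt_snd
  have d3 := d1.clm_apply d2
  -- The differential of `(y, h) ↦ exp (ad y) h` at `(0, x)` is `(y, h) ↦ ⁅y, x⁆ + h`. It is onto by
  -- the Fitting decomposition `M = ker (ad x)^n ⊕ range (ad x)^n`, where `n ≥ 1` puts the second
  -- summand in the range of `ad x`.
  have hsurj := d3.map_nhds_eq_of_surj (by
    rw [LinearMap.range_eq_top]
    intro w
    obtain ⟨m, rfl⟩ := e.surjective w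
    obtain ⟨n, hn, hn1⟩ := ((LinearMap.eventually_isCompl_ker_pow_range_pow
      (LieAlgebra.ad ℂ M x)).and (eventually_ge_atTop 1)).exists
    have hm : m ∈ (⊤ : Submodule ℂ M) := trivial
    rw [← hn.sup_eq_top, Submodule.mem_sup] at hm
    obtain ⟨a, ha, b, ⟨c, hc⟩, rfl⟩ := hm
    obtain ⟨k, rfl⟩ := Nat.exists_eq_add_of_le hn1
    rw [pow_add, pow_one, Module.End.mul_apply] at hc
    refine ⟨(e (-((LieAlgebra.ad ℂ M x ^ k) c)),
      ⟨e a, a, (mem_engel_iff ℂ x a).mpr ⟨_, ha⟩, rfl⟩), ?_⟩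
    have h4 : br (e (-((LieAlgebra.ad ℂ M x ^ k) c))) (e x) = e b := by
      rw [hbr, coordEquiv_apply, ← hc]
      change e _ = e _
      simp
    change NormedSpace.exp (br 0) (e a) + br (e (-((LieAlgebra.ad ℂ M x ^ k) c))) (e x) = _
    rw [h4]
    simp)
  have h5 : Set.range F ∈ 𝓝 (e x) := by
    rw [← hF0]
    change Set.range F ∈ 𝓝 (NormedSpace.exp (br 0) (h₀ : Fin (Module.finrank ℂ M) → ℂ))
    rw [← hsurj]
    exact Filter.mem_of_superset (Filter.image_mem_map Filter.univ_mem) (by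
      rintro _ ⟨p, -, rfl⟩; exact ⟨p, rfl⟩)
  have h6 : Tendsto (fun z : ℂ ↦ e x + z • e v) (𝓝 0) (𝓝 (e x)) := by
    have : Continuous (fun z : ℂ ↦ e x + z • e v) := by fun_prop
    simpa using this.tendsto 0
  filter_upwards [h6 h5] with z hz
  obtain ⟨⟨y, ⟨_, h, hh, rfl⟩⟩, hp⟩ := hz
  refine ⟨e.symm y, h, hh, e.injective ?_⟩
  rw [expAd_apply]
  change (Module.finBasis ℂ M).equivFun _ = _
  rw [equivFun_expEnd, ← hbr, e.apply_symm_apply, map_add, map_smul]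
  exact hp

omit [FiniteDimensional ℂ M] in
lemma apply_mem_engel_iff (q : M ≃ₗ⁅ℂ⁆ M) (x y : M) :
    q y ∈ engel ℂ (q x) ↔ y ∈ engel ℂ x := by
  have h : ∀ n : ℕ, (LieAlgebra.ad ℂ M (q x) ^ n) (q y) = q ((LieAlgebra.ad ℂ M x ^ n) y) := by
    intro n
    induction n with
    | zero => simp
    | succ n ih =>
      rw [pow_succ', pow_succ', Module.End.mul_apply, Module.End.mul_apply, ih]
      exact (q.map_lie x _).symm
  simp only [mem_engel_iff, h, EmbeddingLike.map_eq_zero_iff]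

lemma isRegular_apply_iff (q : M ≃ₗ⁅ℂ⁆ M) (x : M) :
    IsRegular ℂ (q x) ↔ IsRegular ℂ x := by
  rw [isRegular_iff_finrank_engel_eq_rank, isRegular_iff_finrank_engel_eq_rank]
  have : (engel ℂ (q x)).toSubmodule =
      (engel ℂ x).toSubmodule.map (q.toLinearEquiv : M →ₗ[ℂ] M) := by
    ext y
    obtain ⟨y, rfl⟩ := q.surjective y
    refine (apply_mem_engel_iff q x y).trans ?_
    refine ((Submodule.mem_map_equiv _ (e := q.toLinearEquiv)).trans ?_).symm
    change q.symm (q y) ∈ _ ↔ _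
    rw [q.symm_apply_apply]; rfl
  have h2 := LinearEquiv.finrank_map_eq q.toLinearEquiv (engel ℂ x).toSubmodule
  rw [← this] at h2
  change Module.finrank ℂ (engel ℂ (q x)) = Module.finrank ℂ (engel ℂ x) at h2
  rw [h2]

/-- Regularity means least dimension, so this Engel subalgebra is minimal among those of its own
elements. Over an infinite field it is then contained in all of these, so its elements act
nilpotently on it. -/
lemma isCartanSubalgebra_engel_of_isRegular {x : M} (hx : IsRegular ℂ x) :
    (engel ℂ x).IsCartanSubalgebra := by
  have h : (Module.finrank ℂ M : Cardinal) ≤ Cardinal.mk ℂ :=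
    Cardinal.natCast_le_aleph0.trans (Cardinal.infinite_iff.mp inferInstance)
  refine ⟨?_, normalizer_engel _ _⟩
  apply isNilpotent_of_forall_le_engel
  intro y hy
  set Ex : {E | ∃ z ∈ engel ℂ x, engel ℂ z = E} := ⟨engel ℂ x, x, self_mem_engel _ _, rfl⟩
  suffices IsBot Ex from @this ⟨engel ℂ y, y, hy, rfl⟩
  apply engel_isBot_of_isMin h (engel ℂ x) Ex le_rfl
  rintro ⟨_, y, hy, rfl⟩ hyx
  suffices Module.finrank ℂ (engel ℂ x) ≤ Module.finrank ℂ (engel ℂ y) by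
    suffices engel ℂ y = engel ℂ x from this.ge
    apply LieSubalgebra.toSubmodule_injective
    exact Submodule.eq_of_le_of_finrank_le hyx this
  rw [(isRegular_iff_finrank_engel_eq_rank ℂ x).mp hx]
  apply rank_le_finrank_engel

-- Regularity is the nonvanishing of one coefficient of the generic characteristic polynomial of
-- `ad`, which is polynomial along a line. One regular parameter thus leaves only finitely many
-- irregular ones.
attribute [local instance] LieRing.ofAssociativeRing in
lemma exists_polynomial_isRegular (x v : M) :
    ∃ p : Polynomial ℂ, ∀ z : ℂ, IsRegular ℂ (x + z • v) ↔ p.eval z ≠ 0 := by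
  classical
  let b := Module.finBasis ℂ M
  refine ⟨MvPolynomial.aeval (fun i ↦ Polynomial.C (b.repr v i) * Polynomial.X +
    Polynomial.C (b.repr x i)) ((LinearMap.polyCharpoly (LieAlgebra.ad ℂ M).toLinearMap b).coeff
      (rank ℂ M)), fun z ↦ ?_⟩
  rw [isRegular_iff_coeff_polyCharpoly_rank_ne_zero ℂ b, ← Polynomial.coe_evalRingHom]
  generalize (LinearMap.polyCharpoly (LieAlgebra.ad ℂ M).toLinearMap b).coeff (rank ℂ M) = P
  have : (Polynomial.evalRingHom z).comp (MvPolynomial.aeval (fun i ↦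
      Polynomial.C (b.repr v i) * Polynomial.X + Polynomial.C (b.repr x i)) :
      MvPolynomial _ ℂ →ₐ[ℂ] Polynomial ℂ).toRingHom = MvPolynomial.eval (b.repr (x + z • v)) := by
    apply MvPolynomial.ringHom_ext
    · intro r; simp
    · intro i; simp; ring
  rw [← this]
  rfl

variable [IsKilling ℂ M]

lemma lie_eq_zero_of_isRegular {x : M} (hx : IsRegular ℂ x) {a b : M} (ha : a ∈ engel ℂ x)
    (hb : b ∈ engel ℂ x) : ⁅a, b⁆ = 0 := by
  have := isCartanSubalgebra_engel_of_isRegular hx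
  have h : IsLieAbelian (engel ℂ x) := inferInstance
  exact congrArg Subtype.val (h.trivial ⟨a, ha⟩ ⟨b, hb⟩)

lemma engel_eq_of_mem_of_isRegular {x h : M}
    (hx : ∀ a ∈ engel ℂ x, ∀ b ∈ engel ℂ x, ⁅a, b⁆ = 0) (hh : h ∈ engel ℂ x)
    (hr : IsRegular ℂ h) : engel ℂ h = engel ℂ x := by
  have h1 : ∀ a ∈ engel ℂ x, a ∈ engel ℂ h := fun a ha ↦
    (mem_engel_iff ℂ h a).mpr ⟨1, by simpa using hx h hh a ha⟩
  refine le_antisymm (fun a ha ↦ (mem_engel_iff ℂ x a).mpr ⟨1, ?_⟩) h1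
  simpa using lie_eq_zero_of_isRegular hr (h1 x (self_mem_engel ℂ x)) ha

/-- The Engel subalgebras of two elements are conjugate by a quasi-inner automorphism. -/
def EngelConj (x y : M) : Prop :=
  ∃ q : M ≃ₗ⁅ℂ⁆ M, IsQuasiInner q ∧ ∀ a, q a ∈ engel ℂ y ↔ a ∈ engel ℂ x

omit [FiniteDimensional ℂ M] [IsKilling ℂ M] in
lemma EngelConj.trans {x y z : M} : EngelConj x y → EngelConj y z → EngelConj x z :=
  fun ⟨q, hq, h⟩ ⟨r, hr, h'⟩ ↦ ⟨q.trans r, hq.trans hr, fun a ↦ (h' (q a)).trans (h a)⟩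

omit [FiniteDimensional ℂ M] [IsKilling ℂ M] in
lemma EngelConj.symm {x y : M} : EngelConj x y → EngelConj y x :=
  fun ⟨q, hq, h⟩ ↦ ⟨q.symm, hq.symm, fun a ↦ by rw [← h, q.apply_symm_apply]⟩

lemma eventually_engelConj {x : M} (hx : ∀ a ∈ engel ℂ x, ∀ b ∈ engel ℂ x, ⁅a, b⁆ = 0) (v : M) :
    ∀ᶠ z : ℂ in 𝓝 0, IsRegular ℂ (x + z • v) → EngelConj x (x + z • v) := by
  filter_upwards [eventually_exists_expAd x v] with z hz hr
  obtain ⟨y, h, hh, e⟩ := hz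
  rw [← e] at hr ⊢
  refine ⟨expAd y, IsQuasiInner.expAd y, fun a ↦ ?_⟩
  rw [apply_mem_engel_iff, engel_eq_of_mem_of_isRegular hx hh ((isRegular_apply_iff _ _).mp hr)]

/-- On the line to a regular element there are regular points arbitrarily near `x`. Such a point is
conjugate to an `h` in the Engel subalgebra of `x`, which then equals that of `h` and has the
dimension of a regular one. -/
lemma isRegular_of_engel_abelian {x : M}
    (hx : ∀ a ∈ engel ℂ x, ∀ b ∈ engel ℂ x, ⁅a, b⁆ = 0) : IsRegular ℂ x := by
  obtain ⟨x', hx'⟩ := exists_isRegular ℂ M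
  obtain ⟨p, hp⟩ := exists_polynomial_isRegular x (x' - x)
  have hp0 : p ≠ 0 := by
    rintro rfl
    have := (hp 1).mp (by simpa using hx')
    simp at this
  have hd : Dense ({z : ℂ | p.IsRoot z}ᶜ) :=
    (Polynomial.finite_setOfPred_isRoot hp0).countable.dense_compl ℂ
  obtain ⟨z, hz1, hz2⟩ := hd.inter_nhds_nonempty (eventually_exists_expAd x (x' - x))
  obtain ⟨y, h, hh, e⟩ := hz2
  have hr := (hp z).mpr hz1
  rw [← e, isRegular_apply_iff] at hr
  have := engel_eq_of_mem_of_isRegular hx hh hr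
  rw [isRegular_iff_finrank_engel_eq_rank] at hr ⊢
  rw [← this, hr]

/-- Conjugacy of the Cartan subalgebras that are the Engel subalgebras of regular elements. -/
theorem engelConj_of_isRegular {x y : M} (hx : IsRegular ℂ x) (hy : IsRegular ℂ y) :
    EngelConj x y := by
  obtain ⟨p, hp⟩ := exists_polynomial_isRegular x (y - x)
  have hp0 : p ≠ 0 := by
    rintro rfl
    have := (hp 1).mp (by simpa using hy)
    simp at this
  -- The complex line minus finitely many points is connected, and conjugacy is locally constant on
  -- the regular parameters, so it links `0` to `1`.
  have hc : IsPreconnected ({z : ℂ | p.IsRoot z}ᶜ) :=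
    ((Polynomial.finite_setOfPred_isRoot hp0).countable.isConnected_compl_of_one_lt_rank
      (by simp [Complex.rank_real_complex])).isPreconnected
  have key := hc.induction₂ (fun z w ↦ EngelConj (x + z • (y - x)) (x + w • (y - x)))
    (fun z hz ↦ by
      have h1 := eventually_engelConj
        (fun a ha b hb ↦ lie_eq_zero_of_isRegular ((hp z).mpr hz) ha hb) (y - x)
      have h2 : Tendsto (fun w : ℂ ↦ w - z) (𝓝 z) (𝓝 0) := by
        have : Continuous (fun w : ℂ ↦ w - z) := by fun_prop
        simpa using this.tendsto z
      have h3 := h2.eventually h1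
      filter_upwards [mem_nhdsWithin_of_mem_nhds h3, self_mem_nhdsWithin] with w hw hw'
      have e : x + z • (y - x) + (w - z) • (y - x) = x + w • (y - x) := by module
      rw [e] at hw
      exact hw ((hp w).mpr hw'))
    (fun _ _ _ _ _ _ ↦ EngelConj.trans) (fun _ _ _ _ ↦ EngelConj.symm)
    (x := 0) (y := 1) ((hp 0).mp (by simpa using hx)) ((hp 1).mp (by simpa using hy))
  simpa using key

end LieAlgebra

/-! ### Roots relative to canonical generators. -/

namespace LieAlgebra.Basis

open LieModule Module IsKilling

section

variable {M : Type*} [LieRing M] [LieAlgebra ℂ M] {H : LieSubalgebra ℂ M}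

/-- A linear form on a subalgebra `H` is a root if it is a nonzero weight of the adjoint action. -/
def IsRootForm (χ : Dual ℂ H) : Prop :=
  χ ≠ 0 ∧ ∃ v : M, v ≠ 0 ∧ ∀ h : H, ⁅(h : M), v⁆ = χ h • v

/-- The restriction of an automorphism to a subalgebra which it preserves. -/
def restrictEquiv (q : M ≃ₗ⁅ℂ⁆ M) (hq : ∀ a, q a ∈ H ↔ a ∈ H) : H ≃ₗ[ℂ] H :=
  { toFun := fun a ↦ ⟨q a, (hq a).mpr a.2⟩
    map_add' := fun a b ↦ Subtype.ext (map_add q (a : M) b)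
    map_smul' := fun t a ↦ Subtype.ext (map_smul q t (a : M))
    invFun := fun a ↦ ⟨q.symm a, (hq _).mp (by rw [q.apply_symm_apply]; exact a.2)⟩
    left_inv := fun a ↦ Subtype.ext (q.symm_apply_apply _)
    right_inv := fun a ↦ Subtype.ext (q.apply_symm_apply _) }

@[simp] lemma coe_restrictEquiv_symm (q : M ≃ₗ⁅ℂ⁆ M) (hq : ∀ a, q a ∈ H ↔ a ∈ H) (a : H) :
    ((restrictEquiv q hq).symm a : M) = q.symm a := rfl

lemma IsRootForm.comp {χ : Dual ℂ H} (h : IsRootForm χ) (q : M ≃ₗ⁅ℂ⁆ M)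
    (hq : ∀ a, q a ∈ H ↔ a ∈ H) : IsRootForm (χ ∘ₗ (restrictEquiv q hq).toLinearMap) := by
  obtain ⟨h0, v, hv, h⟩ := h
  refine ⟨fun h1 ↦ h0 (LinearMap.ext fun a ↦ ?_), q.symm v, by simpa using hv, fun a ↦ ?_⟩
  · obtain ⟨a, rfl⟩ := (restrictEquiv q hq).surjective a
    exact LinearMap.congr_fun h1 a
  · apply q.injective
    have h1 : q ⁅(a : M), q.symm v⁆ = ⁅q a, q (q.symm v)⁆ := LieEquiv.map_lie q _ _
    have h2 : ∀ t : ℂ, q (t • q.symm v) = t • v := fun t ↦ by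
      rw [map_smul, q.apply_symm_apply]
    refine h1.trans (Eq.trans ?_ (h2 _).symm)
    rw [q.apply_symm_apply]
    exact h (restrictEquiv q hq a)

end

variable {ι M : Type*} [Fintype ι] [LieRing M] [LieAlgebra ℂ M] [FiniteDimensional ℂ M]
  {H : LieSubalgebra ℂ M} (b : LieAlgebra.Basis ι H)

section

omit [FiniteDimensional ℂ M]

/-- The Cartan matrix is invertible. This supplies the strictly dominant element, the basis dual to
the simple roots and the rescaling element below. -/
lemma exists_baseSupp_apply_eq (c : ι → ℂ) : ∃ z : H, ∀ i, b.baseSupp i z = c i := by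
  classical
  let A : Matrix ι ι ℂ := b.A.map (Int.castRingHom ℂ)
  have hA : IsUnit A.det := by
    rw [isUnit_iff_ne_zero]
    have : A.det = (Int.castRingHom ℂ) b.A.det := (RingHom.map_det _ _).symm
    rw [this]
    simpa using b.nondegen.det_ne_zero
  refine ⟨∑ j, (A⁻¹.mulVec c) j • b.h' j, fun i ↦ ?_⟩
  have h1 : A.mulVec (A⁻¹.mulVec c) i = c i := by
    rw [Matrix.mulVec_mulVec, Matrix.mul_nonsing_inv _ hA, Matrix.one_mulVec]
  rw [← h1, map_sum, Matrix.mulVec, dotProduct]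
  refine Finset.sum_congr rfl fun j _ ↦ ?_
  rw [map_smul, baseSupp_apply_h', smul_eq_mul, mul_comm]
  rfl

lemma lie_e (i : ι) (h : H) : ⁅(h : M), b.e i⁆ = b.baseSupp i h • b.e i :=
  (b.baseSupp_apply_smul_e i h).symm

lemma lie_f (i : ι) (h : H) : ⁅(h : M), b.f i⁆ = -(b.baseSupp i h) • b.f i := by
  rw [neg_smul, b.baseSupp_apply_smul_f i h, neg_neg]
  rfl

lemma isRootForm_baseSupp (i : ι) : IsRootForm (b.baseSupp i) :=
  ⟨b.linearIndependent_baseSupp.ne_zero i, b.e i, (b.sl2 i).e_ne_zero, b.lie_e i⟩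

end

variable [IsKilling ℂ M]

lemma exists_eq_sum_of_isRootForm {χ : Dual ℂ H} (hχ : IsRootForm χ) :
    ∃ m : ι → ℕ, χ = ∑ i, m i • b.baseSupp i ∨ χ = -∑ i, m i • b.baseSupp i := by
  classical
  have := b.isCartanSubalgebra
  obtain ⟨h0, v, hv, h⟩ := hχ
  have hmem : v ∈ genWeightSpace M χ :=
    (LieModule.mem_genWeightSpace M _ _).mpr fun x ↦ ⟨1, by simp [h]⟩
  let w : Weight ℂ H M := ⟨χ, fun hb ↦ hv (by rw [hb] at hmem; simpa using hmem)⟩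
  have hw : w ∈ H.root := by
    simp only [LieSubalgebra.root, Finset.mem_filter, Finset.mem_univ, true_and]
    intro h1
    exact h0 (LinearMap.ext fun a ↦ congrFun h1 a)
  have hwχ : (rootSystem H).root ⟨w, hw⟩ = χ := by ext; rfl
  have key := b.root_mem_or_mem_neg ⟨w, hw⟩
  have hcl : ∀ ψ ∈ AddSubmonoid.closure ((rootSystem H).root '' Set.range b.baseSupp'),
      ∃ m : ι → ℕ, ψ = ∑ i, m i • b.baseSupp i := by
    intro ψ hψ
    induction hψ using AddSubmonoid.closure_induction with
    | mem ψ hψ =>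
      obtain ⟨_, ⟨i, rfl⟩, rfl⟩ := hψ
      refine ⟨Pi.single i 1, ?_⟩
      rw [Finset.sum_eq_single i (fun j _ hj ↦ by simp [hj]) (by simp)]
      simp
    | zero => exact ⟨0, by simp⟩
    | add ψ ψ' _ _ h h' =>
      obtain ⟨m, rfl⟩ := h
      obtain ⟨m', rfl⟩ := h'
      exact ⟨m + m', by simp [add_smul, Finset.sum_add_distrib]⟩
  rw [hwχ] at key
  rcases key with h | h
  · obtain ⟨m, hm⟩ := hcl _ h
    exact ⟨m, Or.inl hm⟩
  · obtain ⟨m, hm⟩ := hcl _ h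
    exact ⟨m, Or.inr (by rw [← hm, neg_neg])⟩

lemma exists_eq_smul_e {v : M} (i : ι) (hv : ∀ h : H, ⁅(h : M), v⁆ = b.baseSupp i h • v) :
    ∃ c : ℂ, v = c • b.e i := by
  have := b.isCartanSubalgebra
  have h1 := finrank_rootSpace_eq_one (b.baseSupp' i).1 (LieSubalgebra.isNonZero_coe_root _)
  have hmem : ∀ w : M, (∀ h : H, ⁅(h : M), w⁆ = b.baseSupp i h • w) →
      w ∈ rootSpace H (b.baseSupp' i).1 := fun w hw ↦
    (LieModule.mem_genWeightSpace M _ _).mpr fun x ↦ ⟨1, by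
      simp only [pow_one, LinearMap.sub_apply, LinearMap.smul_apply, Module.End.one_apply,
        LieModule.toEnd_apply_apply]
      exact sub_eq_zero.mpr (hw x)⟩
  obtain ⟨c, hc⟩ := (finrank_eq_one_iff_of_nonzero'
    (⟨b.e i, hmem _ (b.lie_e i)⟩ : rootSpace H (b.baseSupp' i).1)
    (fun h ↦ (b.sl2 i).e_ne_zero (congrArg Subtype.val h))).mp h1 ⟨v, hmem v hv⟩
  exact ⟨c, (congrArg Subtype.val hc).symm⟩

lemma exists_eq_smul_f {v : M} (i : ι) (hv : ∀ h : H, ⁅(h : M), v⁆ = -(b.baseSupp i h) • v) :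
    ∃ c : ℂ, v = c • b.f i := by
  refine b.symm.exists_eq_smul_e i fun h ↦ ?_
  rw [symm_baseSupp, hv]
  rfl

omit [IsKilling ℂ M] in
include b in
/-- The Cartan subalgebra is the Engel subalgebra of any element on which all roots are nonzero. -/
lemma mem_engel_iff_mem_cartan {x₀ : H} (hx₀ : ∀ χ : Dual ℂ H, IsRootForm χ → χ x₀ ≠ 0) (a : M) :
    a ∈ LieSubalgebra.engel ℂ (x₀ : M) ↔ a ∈ H := by
  have := b.isCartanSubalgebra
  let f : Module.End ℂ M := LieAlgebra.ad ℂ M x₀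
  have hH0 : H.toLieSubmodule = genWeightSpace M (0 : H → ℂ) := b.cartan_eq
  have hle : H.toSubmodule ≤ f.maxGenEigenspace 0 := by
    intro y hy
    refine (LieSubalgebra.mem_engel_iff ℂ (x₀ : M) y).mpr ⟨1, ?_⟩
    have h : IsLieAbelian H := b.isLieAbelian_cartan
    have := congrArg Subtype.val (h.trivial x₀ ⟨y, hy⟩)
    simpa using this
  -- Each root space lies in a generalized eigenspace of `ad x₀` with nonzero eigenvalue `χ x₀`.
  -- Hence `H` and `Q` fill `M`, and independence of eigenspaces leaves exactly `H` for the
  -- eigenvalue zero.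
  let Q : Submodule ℂ M := ⨆ c : ℂ, ⨆ (_ : c ≠ 0), f.maxGenEigenspace c
  have htop : H.toSubmodule ⊔ Q = ⊤ := by
    rw [eq_top_iff]
    have h1 := LieModule.iSup_genWeightSpace_eq_top ℂ H M
    have h2 : (⨆ χ : H → ℂ, (genWeightSpace M χ).toSubmodule) = ⊤ := by
      rw [← LieSubmodule.iSup_toSubmodule, h1]; rfl
    rw [← h2]
    refine iSup_le fun χ ↦ ?_
    by_cases hχ : χ = 0
    · subst hχ
      rw [← hH0]
      exact le_sup_left
    by_cases hb : genWeightSpace M χ = ⊥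
    · rw [hb]; simp
    refine le_trans ?_ le_sup_right
    let w : Weight ℂ H M := ⟨χ, hb⟩
    have hw : χ x₀ ≠ 0 := by
      obtain ⟨v, hv0, hv⟩ := exists_forall_lie_eq_smul ℂ H M w
      exact hx₀ w.toLinear ⟨fun h ↦ hχ (funext fun a ↦ LinearMap.congr_fun h a), v, hv0, hv⟩
    refine le_trans ?_ (le_iSup₂_of_le (χ x₀) hw le_rfl)
    exact genWeightSpace_le_genWeightSpaceOf M x₀ χ
  have hdisj : Disjoint (f.maxGenEigenspace 0) Q := f.independent_maxGenEigenspace 0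
  have key : f.maxGenEigenspace 0 = H.toSubmodule := by
    refine le_antisymm ?_ hle
    intro y hy
    have : y ∈ H.toSubmodule ⊔ Q := htop ▸ Submodule.mem_top
    obtain ⟨h, hh, z, hz, rfl⟩ := Submodule.mem_sup.mp this
    have hz0 : z ∈ f.maxGenEigenspace 0 := by
      have := sub_mem hy (hle hh)
      simpa using this
    have := Submodule.disjoint_def.mp hdisj z hz0 hz
    rw [this, add_zero]; exact hh
  change a ∈ f.maxGenEigenspace 0 ↔ a ∈ H.toSubmodule
  rw [key]

end LieAlgebra.Basis

/-- A matrix of natural numbers whose inverse also has natural entries is a permutation matrix. -/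
lemma Matrix.exists_perm_of_mul_eq_one {ι : Type*} [Fintype ι] [DecidableEq ι] {B C : Matrix ι ι ℕ}
    (hBC : B * C = 1) (hCB : C * B = 1) :
    ∃ π : Equiv.Perm ι, ∀ i j, B i j = if j = π i then 1 else 0 := by
  have h1 : ∀ i, ∃ j, B i j * C j i ≠ 0 := by
    intro i
    by_contra! h
    have := congrFun (congrFun hBC i) i
    rw [Matrix.mul_apply, Finset.sum_eq_zero (fun j _ ↦ h j), Matrix.one_apply_eq] at this
    exact zero_ne_one this
  choose p hp using h1
  have hle : ∀ (X Y : Matrix ι ι ℕ) i j k, X i j * Y j k ≤ (X * Y) i k := fun X Y i j k ↦ by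
    rw [Matrix.mul_apply]
    exact Finset.single_le_sum (f := fun j ↦ X i j * Y j k) (fun _ _ ↦ Nat.zero_le _)
      (Finset.mem_univ j)
  have hpos : ∀ i, B i (p i) ≠ 0 ∧ C (p i) i ≠ 0 := fun i ↦ mul_ne_zero_iff.mp (hp i)
  -- Natural numbers do not cancel: a second nonzero entry in row `i` of `B` would produce a nonzero
  -- off-diagonal entry of `C * B`.
  have huniq : ∀ i j, B i j ≠ 0 → j = p i := by
    intro i j hj
    by_contra hne
    have := hle C B (p i) i j
    rw [hCB, Matrix.one_apply_ne (Ne.symm hne)] at this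
    exact mul_ne_zero (hpos i).2 hj (Nat.le_zero.mp this)
  have hinj : Function.Injective p := by
    intro i i' h
    by_contra hne
    have := hle B C i (p i) i'
    rw [hBC, Matrix.one_apply_ne hne] at this
    refine mul_ne_zero (hpos i).1 ?_ (Nat.le_zero.mp this)
    rw [h]; exact (hpos i').2
  refine ⟨Equiv.ofBijective p (Finite.injective_iff_bijective.mp hinj), fun i j ↦ ?_⟩
  rw [Equiv.ofBijective_apply]
  split_ifs with h
  · subst h
    have := hle B C i (p i) i
    rw [hBC, Matrix.one_apply_eq] at this
    have h2 := hpos i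
    exact Nat.dvd_one.mp (Dvd.intro _ (le_antisymm this (Nat.one_le_iff_ne_zero.mpr (hp i))))
  · by_contra h0
    exact h (huniq i j h0)

/-! ### Simple reflections and dominance. -/

namespace LieAlgebra.Basis

open LieModule Module IsKilling

lemma expAd_apply_of_pow_three {M : Type*} [LieRing M] [LieAlgebra ℂ M] [FiniteDimensional ℂ M]
    {x y : M} (h : ⁅x, ⁅x, ⁅x, y⁆⁆⁆ = 0) :
    expAd x y = y + ⁅x, y⁆ + (2⁻¹ : ℂ) • ⁅x, ⁅x, y⁆⁆ :=
  Module.End.expEnd_apply_of_pow_three (f := LieAlgebra.ad ℂ M x) h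

variable {ι : Type*} {M : Type u} [Fintype ι] [LieRing M] [LieAlgebra ℂ M] [FiniteDimensional ℂ M]
  {H : LieSubalgebra ℂ M} (b : LieAlgebra.Basis ι H)

omit [FiniteDimensional ℂ M] in
lemma baseSupp_apply_h'_self (i : ι) : b.baseSupp i (b.h' i) = 2 := by
  have : IsAddTorsionFree M := .of_isTorsionFree ℂ M
  rw [baseSupp_apply_h', A_diag_eq_two]
  norm_num

/-- The simple reflections are induced by quasi-inner automorphisms. -/
lemma exists_reflection (i : ι) :
    ∃ s : M ≃ₗ⁅ℂ⁆ M, IsQuasiInner s ∧ ∀ a : H, s a = a - b.baseSupp i a • b.h i := by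
  have hs := b.sl2 i
  have he1 : ∀ a : H, expAd (b.e i) a = a - b.baseSupp i a • b.e i := fun a ↦ by
    have h1 : ⁅b.e i, (a : M)⁆ = -(b.baseSupp i a • b.e i) := by rw [← lie_skew, b.lie_e]
    have h2 : ⁅b.e i, ⁅b.e i, (a : M)⁆⁆ = 0 := by rw [h1, lie_neg, lie_smul, lie_self]; simp
    rw [expAd_apply_of_pow_three (by rw [h2, lie_zero]), h2, h1, smul_zero]
    module
  have hf1 : ∀ a : H, expAd (-b.f i) a = a - b.baseSupp i a • b.f i := fun a ↦ by
    have h1 : ⁅-b.f i, (a : M)⁆ = -(b.baseSupp i a • b.f i) := by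
      rw [neg_lie, lie_skew, b.lie_f, neg_smul]
    have h2 : ⁅-b.f i, ⁅-b.f i, (a : M)⁆⁆ = 0 := by
      rw [h1, lie_neg, lie_smul, neg_lie, lie_self]; simp
    rw [expAd_apply_of_pow_three (by rw [h2, lie_zero]), h2, h1, smul_zero]
    module
  have hf2 : expAd (-b.f i) (b.e i) = b.e i + b.h i - b.f i := by
    have h1 : ⁅-b.f i, b.e i⁆ = b.h i := by rw [neg_lie, lie_skew, hs.lie_e_f]
    have h2 : ⁅-b.f i, b.h i⁆ = -((2 : ℂ) • b.f i) := by
      rw [neg_lie, lie_skew, hs.lie_h_f_nsmul, ← ofNat_smul_eq_nsmul ℂ]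
    rw [expAd_apply_of_pow_three (by simp [h1, h2]), h1, h2]
    module
  -- The usual lift `exp (ad e) exp (-ad f) exp (ad e)` of a simple reflection; on the vectors
  -- needed, each series stops by the quadratic term.
  refine ⟨(expAd (b.e i)).trans ((expAd (-b.f i)).trans (expAd (b.e i))),
    (IsQuasiInner.expAd _).trans ((IsQuasiInner.expAd _).trans (IsQuasiInner.expAd _)), fun a ↦ ?_⟩
  simp only [LieEquiv.trans_apply, he1, map_sub, map_smul, hf1, hf2]
  have h3 : expAd (b.e i) (b.h i) = b.h i - (2 : ℂ) • b.e i := by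
    have := he1 (b.h' i)
    rwa [baseSupp_apply_h'_self] at this
  have h4 : expAd (b.e i) (b.e i) = b.e i := by
    rw [expAd_apply_of_pow_three (by simp)]; simp
  simp only [map_add, h3, h4]
  module

variable [IsKilling ℂ M]

lemma exists_pos_sum {χ : Dual ℂ H} (hχ : IsRootForm χ) : ∃ m : ι → ℕ, 0 < ∑ i, m i ∧
    (χ = ∑ i, m i • b.baseSupp i ∨ χ = -∑ i, m i • b.baseSupp i) := by
  obtain ⟨m, hm⟩ := b.exists_eq_sum_of_isRootForm hχ
  refine ⟨m, Nat.pos_of_ne_zero fun h ↦ hχ.1 ?_, hm⟩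
  have h0 : ∀ i, m i = 0 := fun i ↦ Finset.sum_eq_zero_iff.mp h i (Finset.mem_univ i)
  simpa [h0] using hm

lemma exists_int_apply {χ : Dual ℂ H} (hχ : IsRootForm χ) {y : H}
    (hy : ∀ i, ∃ k : ℤ, b.baseSupp i y = k) : ∃ k : ℤ, χ y = k := by
  choose k hk using hy
  obtain ⟨m, -, rfl | rfl⟩ := b.exists_pos_sum hχ
  · exact ⟨∑ i, m i * k i, by simp [hk]⟩
  · exact ⟨-∑ i, m i * k i, by simp [hk]⟩

/-- The value is `∑ α(y)²` over the roots, a sum of squares of integers. It serves as the quantity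
that descends in `exists_dominant`. -/
lemma killingForm_eq_natCast {y : H} (hy : ∀ i, ∃ k : ℤ, b.baseSupp i y = k) :
    ∃ N : ℕ, killingForm ℂ M y y = N ∧ ∀ i, b.baseSupp i y ≠ 0 → 0 < N := by
  classical
  have := b.isCartanSubalgebra
  have hroot : ∀ α ∈ H.root, IsRootForm (Weight.toLinear ℂ H M α) := fun α hα ↦ by
    have hα' : α.IsNonZero := by simpa [LieSubalgebra.root] using hα
    obtain ⟨v, hv0, hv⟩ := exists_forall_lie_eq_smul ℂ H M α
    exact ⟨fun h ↦ hα' (funext fun a ↦ LinearMap.congr_fun h a), v, hv0, hv⟩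
  have h1 : ∀ α : H.root, ∃ k : ℤ, α.1 y = k := fun α ↦ b.exists_int_apply (hroot α.1 α.2) hy
  choose k hk using h1
  have hsum : killingForm ℂ M y y = ((∑ α : H.root, k α ^ 2 : ℤ) : ℂ) := by
    have h2 := LinearMap.congr_fun₂ (restrict_killingForm_eq_sum (K := ℂ) (L := M) (H := H)) y y
    have h3 : (killingForm ℂ M).restrict H y y = killingForm ℂ M y y := rfl
    rw [← h3, h2, ← Finset.sum_coe_sort (s := H.root)]
    have h4 : ∀ α : H.root, Weight.toLinear ℂ H M α y = k α := hk
    simp [LinearMap.sum_apply, h4, sq]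
  have hnn : 0 ≤ ∑ α : H.root, k α ^ 2 := Finset.sum_nonneg fun α _ ↦ sq_nonneg _
  obtain ⟨N, hN⟩ := Int.eq_ofNat_of_zero_le hnn
  refine ⟨N, by rw [hsum, hN]; simp, fun i hi ↦ ?_⟩
  have h4 : k (b.baseSupp' i) ≠ 0 := by
    intro h0
    have := hk (b.baseSupp' i)
    rw [h0] at this
    exact hi (this.trans (by simp))
  have h5 : k (b.baseSupp' i) ^ 2 ≤ ∑ α : H.root, k α ^ 2 :=
    Finset.single_le_sum (f := fun α ↦ k α ^ 2) (fun α _ ↦ sq_nonneg _) (Finset.mem_univ _)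
  have h6 : 0 < k (b.baseSupp' i) ^ 2 := by positivity
  omega

omit [IsKilling ℂ M] [FiniteDimensional ℂ M] in
lemma killingForm_h (i : ι) (a : H) :
    killingForm ℂ M a (b.h i) = b.baseSupp i a * killingForm ℂ M (b.e i) (b.f i) := by
  rw [← (b.sl2 i).lie_e_f, ← LieModule.traceForm_apply_lie_apply, b.lie_e, map_smul]
  rfl

/-- Any automorphism preserving the Cartan subalgebra maps a strictly dominant element to a strictly
dominant one, after modification by a quasi-inner automorphism. -/
lemma exists_dominant {x₀ : H} (hx₀ : ∀ i, b.baseSupp i x₀ = 1) (τ : M ≃ₗ⁅ℂ⁆ M)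
    (hτ : ∀ a, τ a ∈ H ↔ a ∈ H) : ∃ w : M ≃ₗ⁅ℂ⁆ M, IsQuasiInner w ∧
      ∃ hw : ∀ a, (τ.trans w) a ∈ H ↔ a ∈ H,
        ∀ i, ∃ k : ℕ, 0 < k ∧ b.baseSupp i (restrictEquiv (τ.trans w) hw x₀) = k := by
  classical
  have hx₀' : ∀ i, ∃ k : ℤ, b.baseSupp i x₀ = k := fun i ↦ ⟨1, by simp [hx₀]⟩
  have hint : ∀ (q : M ≃ₗ⁅ℂ⁆ M) (hq : ∀ a, q a ∈ H ↔ a ∈ H) (i : ι),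
      ∃ k : ℤ, k ≠ 0 ∧ b.baseSupp i (restrictEquiv q hq x₀) = k := fun q hq i ↦ by
    have hr := (b.isRootForm_baseSupp i).comp q hq
    obtain ⟨m, hm, h | h⟩ := b.exists_pos_sum hr
    · refine ⟨∑ i, m i, by exact_mod_cast hm.ne', ?_⟩
      refine (LinearMap.congr_fun h x₀).trans ?_
      simp [hx₀]
    · refine ⟨-∑ i, m i, neg_ne_zero.mpr (by exact_mod_cast hm.ne'), ?_⟩
      refine (LinearMap.congr_fun h x₀).trans ?_
      simp [hx₀]
  -- The values of the squared Killing distance from `x₀` to its image; a `w` attaining the least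
  -- one will do.
  let P : ℕ → Prop := fun N ↦ ∃ w : M ≃ₗ⁅ℂ⁆ M, IsQuasiInner w ∧
    ∃ hw : ∀ a, (τ.trans w) a ∈ H ↔ a ∈ H,
      killingForm ℂ M (x₀ - restrictEquiv (τ.trans w) hw x₀ : H)
        (x₀ - restrictEquiv (τ.trans w) hw x₀ : H) = N
  have hP : ∀ (w : M ≃ₗ⁅ℂ⁆ M), IsQuasiInner w → ∀ (hw : ∀ a, (τ.trans w) a ∈ H ↔ a ∈ H),
      ∃ N : ℕ, P N ∧ killingForm ℂ M (x₀ - restrictEquiv (τ.trans w) hw x₀ : H)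
        (x₀ - restrictEquiv (τ.trans w) hw x₀ : H) = N := fun w hqi hw ↦ by
    obtain ⟨N, hN, -⟩ := b.killingForm_eq_natCast (y := x₀ - restrictEquiv (τ.trans w) hw x₀)
      (fun i ↦ by
        obtain ⟨k, -, hk⟩ := hint _ hw i
        exact ⟨1 - k, by rw [map_sub, hx₀, hk]; push_cast; rfl⟩)
    exact ⟨N, ⟨w, hqi, hw, hN⟩, hN⟩
  have hex : ∃ N, P N := by
    obtain ⟨N, hN, -⟩ := hP LieEquiv.refl IsQuasiInner.refl (fun a ↦ hτ a)
    exact ⟨N, hN⟩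
  obtain ⟨w, hqi, hw, hN⟩ := Nat.find_spec hex
  refine ⟨w, hqi, hw, fun i ↦ ?_⟩
  obtain ⟨k, hk0, hk⟩ := hint _ hw i
  suffices hpos : 0 ≤ k by
    obtain ⟨n, rfl⟩ := Int.eq_ofNat_of_zero_le hpos
    exact ⟨n, by omega, by rw [hk]; simp⟩
  by_contra! hneg
  obtain ⟨s, hs, hs'⟩ := b.exists_reflection i
  have hsH : ∀ a, s a ∈ H ↔ a ∈ H := by
    have h1 : ∀ a ∈ H, s a ∈ H := fun a ha ↦ by
      have := hs' ⟨a, ha⟩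
      rw [this]
      exact sub_mem ha (H.smul_mem _ (b.h' i).2)
    intro a
    refine ⟨fun ha ↦ ?_, h1 a⟩
    have h2 : H.toSubmodule.map (s.toLinearEquiv : M →ₗ[ℂ] M) = H.toSubmodule := by
      refine Submodule.eq_of_le_of_finrank_eq ?_ (LinearEquiv.finrank_map_eq s.toLinearEquiv _)
      rintro _ ⟨a, ha, rfl⟩
      exact h1 a ha
    have h3 : s a ∈ H.toSubmodule.map (s.toLinearEquiv : M →ₗ[ℂ] M) := by rw [h2]; exact ha
    obtain ⟨a', ha', e⟩ := h3
    rwa [← s.injective e]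
  have hws : ∀ a, (τ.trans (w.trans s)) a ∈ H ↔ a ∈ H := fun a ↦ (hsH _).trans (hw a)
  obtain ⟨N', hPN', hN'⟩ := hP _ (hqi.trans hs) hws
  obtain ⟨n, hn, hn0⟩ := b.killingForm_eq_natCast (y := b.h' i) (fun j ↦ ⟨b.A j i, by simp⟩)
  have hnpos : 0 < n := hn0 i (by rw [b.baseSupp_apply_h'_self]; exact two_ne_zero)
  set y := restrictEquiv (τ.trans w) hw x₀ with hy
  have hy' : (restrictEquiv (τ.trans (w.trans s)) hws x₀ : M) = y - (k : ℂ) • b.h i := by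
    rw [← hk]; exact hs' y
  -- The reflection turns `x₀ - y` into `x₀ - y + k hᵢ`. As the simple root takes the value `1 - k`
  -- on `x₀ - y`, the squared length changes by `k(1 - k)n + k²n = kn`, where `n = κ(hᵢ, hᵢ) > 0`.
  -- For `k < 0` this contradicts minimality.
  have key : (N' : ℂ) = (Nat.find hex : ℂ) + k * n := by
    rw [← hN', ← hN, ← hn]
    have e1 : ((x₀ - restrictEquiv (τ.trans (w.trans s)) hws x₀ : H) : M) =
        ((x₀ - y : H) : M) + (k : ℂ) • b.h i := by
      change (x₀ : M) - (restrictEquiv (τ.trans (w.trans s)) hws x₀ : M) = (x₀ : M) - (y : M) + _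
      rw [hy']; abel
    have e2 : killingForm ℂ M (b.h i) ((x₀ - y : H) : M) =
        killingForm ℂ M ((x₀ - y : H) : M) (b.h i) := LieModule.traceForm_comm ℂ M M _ _
    have e3 := b.killingForm_h i (x₀ - y)
    have e4 := b.killingForm_h i (b.h' i)
    rw [map_sub, hx₀, hk] at e3
    rw [b.baseSupp_apply_h'_self] at e4
    change killingForm ℂ M (b.h i) (b.h i) = _ at e4
    change _ = _ + _ * killingForm ℂ M (b.h i) (b.h i)
    rw [e1]
    simp only [map_add, map_smul, LinearMap.add_apply, LinearMap.smul_apply, smul_eq_mul, e2, e3,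
      e4]
    push_cast
    ring
  have key' : (N' : ℤ) = (Nat.find hex : ℤ) + k * n := by exact_mod_cast key
  have hlt : N' < Nat.find hex := by nlinarith
  exact Nat.find_min hex hlt hPN'

end LieAlgebra.Basis

/-! ### Factorization of automorphisms. -/

namespace LieAlgebra.Basis

open LieModule Module IsKilling

variable {ι : Type*} {M : Type u} [Fintype ι] [LieRing M] [LieAlgebra ℂ M] [FiniteDimensional ℂ M]
  {H : LieSubalgebra ℂ M} (b : LieAlgebra.Basis ι H)

section

variable [IsKilling ℂ M]

/-- An automorphism which preserves the Cartan subalgebra and strict dominance of an element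
permutes the simple roots. -/
lemma exists_perm_of_dominant {x₀ : H} (hx₀ : ∀ i, b.baseSupp i x₀ = 1) (τ : M ≃ₗ⁅ℂ⁆ M)
    (hτ : ∀ a, τ a ∈ H ↔ a ∈ H)
    (hpos : ∀ i, ∃ k : ℕ, 0 < k ∧ b.baseSupp i (restrictEquiv τ hτ x₀) = k) :
    ∃ π : Equiv.Perm ι, ∀ i a, b.baseSupp i (restrictEquiv τ hτ a) = b.baseSupp (π i) a := by
  classical
  have hτ' : ∀ a, τ.symm a ∈ H ↔ a ∈ H := fun a ↦ by
    rw [← hτ, τ.apply_symm_apply]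
  -- A pulled-back simple root is a root, so its coefficients have one sign; its positive value at
  -- `x₀` makes them nonnegative.
  have hB : ∀ i, ∃ m : ι → ℕ, ∀ a, b.baseSupp i (restrictEquiv τ hτ a) =
      ∑ j, (m j : ℂ) * b.baseSupp j a := fun i ↦ by
    obtain ⟨m, hm, h | h⟩ := b.exists_pos_sum ((b.isRootForm_baseSupp i).comp τ hτ)
    · refine ⟨m, fun a ↦ (LinearMap.congr_fun h a).trans ?_⟩
      simp
    · exfalso
      obtain ⟨k, hk, hk'⟩ := hpos i
      have h1 := LinearMap.congr_fun h x₀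
      rw [LinearMap.comp_apply] at h1
      have h2 : (k : ℂ) = -∑ j, (m j : ℂ) := hk'.symm.trans (h1.trans (by simp [hx₀]))
      have h3 : (k : ℂ) + (∑ j, m j : ℕ) = 0 := by push_cast; rw [h2]; ring
      have h4 : k + ∑ j, m j = 0 := by exact_mod_cast h3
      omega
  have hC : ∀ i, ∃ m : ι → ℕ, ∀ a, b.baseSupp i (restrictEquiv τ.symm hτ' a) =
      ∑ j, (m j : ℂ) * b.baseSupp j a := fun i ↦ by
    obtain ⟨m, hm, h | h⟩ := b.exists_pos_sum ((b.isRootForm_baseSupp i).comp τ.symm hτ')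
    · refine ⟨m, fun a ↦ (LinearMap.congr_fun h a).trans ?_⟩
      simp
    · exfalso
      choose k hk hk' using hpos
      -- For the inverse the test point is `τ x₀`: the pulled-back root equals `1` there and all
      -- simple roots are positive.
      have h1 := LinearMap.congr_fun h (restrictEquiv τ hτ x₀)
      rw [LinearMap.comp_apply] at h1
      have h0 : (restrictEquiv τ.symm hτ') (restrictEquiv τ hτ x₀) = x₀ :=
        Subtype.ext (τ.symm_apply_apply _)
      have h2 : (1 : ℂ) = -∑ j, (m j : ℂ) * k j := by
        rw [← hx₀ i, ← h0]
        refine h1.trans (by simp [hk'])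
      have h3 : (1 : ℂ) + (∑ j, m j * k j : ℕ) = 0 := by push_cast; rw [h2]; ring
      have h4 : 1 + ∑ j, m j * k j = 0 := by exact_mod_cast h3
      omega
  choose B hB using hB
  choose C hC using hC
  choose z hz using fun j ↦ b.exists_baseSupp_apply_eq (Pi.single j 1)
  have hz' : ∀ (m : ι → ℂ) j, ∑ i, m i * b.baseSupp i (z j) = m j := fun m j ↦ by
    rw [Finset.sum_eq_single j (fun i _ hi ↦ by rw [hz, Pi.single_eq_of_ne hi, mul_zero]) (by simp),
      hz, Pi.single_eq_same, mul_one]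
  have aux : ∀ (X Y : ι → ι → ℕ) (q r : H → H) (_ : ∀ a, r (q a) = a)
      (_ : ∀ i a, b.baseSupp i (q a) = ∑ j, (X i j : ℂ) * b.baseSupp j a)
      (_ : ∀ i a, b.baseSupp i (r a) = ∑ j, (Y i j : ℂ) * b.baseSupp j a),
      Matrix.of Y * Matrix.of X = 1 := fun X Y q r hrq hX hY ↦ by
    ext i j
    have h1 : b.baseSupp i (z j) = ∑ l, (Y i l : ℂ) * X l j := by
      rw [← hrq (z j), hY]
      exact Finset.sum_congr rfl fun l _ ↦ by rw [hX, hz' (fun j ↦ (X l j : ℂ))]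
    rw [hz] at h1
    rw [Matrix.mul_apply, Matrix.one_apply]
    have h2 : ((∑ l, Y i l * X l j : ℕ) : ℂ) = ((if i = j then 1 else 0 : ℕ) : ℂ) := by
      push_cast
      rw [← h1, Pi.single_apply]
    exact_mod_cast h2
  have h1 := aux B C _ _ (fun a ↦ Subtype.ext (τ.symm_apply_apply _)) hB hC
  have h2 := aux C B _ _ (fun a ↦ Subtype.ext (τ.apply_symm_apply _)) hC hB
  obtain ⟨π, hπ⟩ := Matrix.exists_perm_of_mul_eq_one h2 h1
  refine ⟨π, fun i a ↦ ?_⟩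
  rw [hB]
  have h3 : ∀ j, B i j = if j = π i then 1 else 0 := hπ i
  simp [h3]

end

omit [FiniteDimensional ℂ M] in
lemma lie_coe_h (i : ι) (a : H) : ⁅(a : M), b.h i⁆ = 0 := by
  have h : IsLieAbelian H := b.isLieAbelian_cartan
  exact congrArg Subtype.val (h.trivial a (b.h' i))

variable [IsKilling ℂ M]

/-- Every automorphism of a semisimple Lie algebra is the product of a quasi-inner one and one which
permutes the canonical generators. -/
theorem exists_isQuasiInner_mul_perm (σ : M ≃ₗ⁅ℂ⁆ M) :
    ∃ (π : Equiv.Perm ι) (q δ : M ≃ₗ⁅ℂ⁆ M), IsQuasiInner q ∧ (∀ x, σ x = q (δ x)) ∧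
      ∀ i, δ (b.h i) = b.h (π i) ∧ δ (b.e i) = b.e (π i) ∧ δ (b.f i) = b.f (π i) := by
  classical
  -- No root vanishes on this element, so `H` is its Engel subalgebra and it is regular. Conjugacy
  -- then brings `σ(H)` back to `H`.
  obtain ⟨x₀, hx₀⟩ := b.exists_baseSupp_apply_eq fun _ ↦ 1
  have hroot : ∀ χ : Dual ℂ H, IsRootForm χ → χ x₀ ≠ 0 := fun χ hχ ↦ by
    obtain ⟨m, hm, rfl | rfl⟩ := b.exists_pos_sum hχ
    · have : ((∑ i, m i : ℕ) : ℂ) ≠ 0 := by exact_mod_cast hm.ne'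
      simpa [hx₀] using this
    · have : ((∑ i, m i : ℕ) : ℂ) ≠ 0 := by exact_mod_cast hm.ne'
      simpa [hx₀] using this
  have hE := b.mem_engel_iff_mem_cartan hroot
  have hab : IsLieAbelian H := b.isLieAbelian_cartan
  have hreg : IsRegular ℂ (x₀ : M) := isRegular_of_engel_abelian fun a ha c hc ↦
    congrArg Subtype.val (hab.trivial ⟨a, (hE a).mp ha⟩ ⟨c, (hE c).mp hc⟩)
  obtain ⟨q₀, hq₀, hq₀'⟩ := engelConj_of_isRegular ((isRegular_apply_iff σ x₀).mpr hreg) hreg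
  have hτ : ∀ a, (σ.trans q₀) a ∈ H ↔ a ∈ H := fun a ↦ by
    rw [← hE, LieEquiv.trans_apply, hq₀', apply_mem_engel_iff, hE]
  obtain ⟨w, hw, hwH, hdom⟩ := b.exists_dominant hx₀ (σ.trans q₀) hτ
  set τ := (σ.trans q₀).trans w with hτdef
  obtain ⟨π, hπ⟩ := b.exists_perm_of_dominant hx₀ τ hwH hdom
  have hπ' : ∀ j (a : H), b.baseSupp j (restrictEquiv τ hwH a) = b.baseSupp (π j) a := hπ
  have hmove : ∀ (v : M) (a : H) (c : ℂ), ⁅((restrictEquiv τ hwH).symm a : M), v⁆ = c • v →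
      ⁅(a : M), τ v⁆ = c • τ v := fun v a c h ↦ by
    have h1 := congrArg τ h
    rw [LieEquiv.map_lie, coe_restrictEquiv_symm, τ.apply_symm_apply] at h1
    exact h1.trans (map_smul τ c v)
  have hsymm : ∀ j a, b.baseSupp j ((restrictEquiv τ hwH).symm a) = b.baseSupp (π.symm j) a :=
    fun j a ↦ by
      have := hπ' (π.symm j) ((restrictEquiv τ hwH).symm a)
      rw [LinearEquiv.apply_symm_apply, Equiv.apply_symm_apply] at this
      exact this.symm
  have he : ∀ i, ∃ c : ℂ, τ (b.e i) = c • b.e (π.symm i) := fun i ↦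
    b.exists_eq_smul_e _ fun a ↦ hmove _ a _ (by rw [lie_e, hsymm])
  have hf : ∀ i, ∃ c : ℂ, τ (b.f i) = c • b.f (π.symm i) := fun i ↦
    b.exists_eq_smul_f _ fun a ↦ hmove _ a _ (by rw [lie_f, hsymm])
  choose c hc using he
  choose d hd using hf
  have hh : ∀ i, τ (b.h i) = (c i * d i) • b.h (π.symm i) := fun i ↦ by
    rw [← (b.sl2 i).lie_e_f, LieEquiv.map_lie, hc, hd, smul_lie, lie_smul, (b.sl2 _).lie_e_f,
      smul_smul]
  have hc0 : ∀ i, c i ≠ 0 := fun i h0 ↦ by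
    have := hc i
    rw [h0, zero_smul] at this
    exact (b.sl2 i).e_ne_zero (τ.injective (this.trans (map_zero τ).symm))
  have hcd : ∀ i, c i * d i = 1 := fun i ↦ by
    have h1 : ⁅τ (b.h i), τ (b.e i)⁆ = (2 : ℂ) • τ (b.e i) := by
      have h2 := b.lie_e i (b.h' i)
      rw [b.baseSupp_apply_h'_self] at h2
      have h3 := congrArg τ h2
      rw [LieEquiv.map_lie] at h3
      exact h3.trans (map_smul τ _ _)
    have h2 := b.lie_e (π.symm i) (b.h' (π.symm i))
    rw [b.baseSupp_apply_h'_self] at h2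
    change ⁅b.h (π.symm i), _⁆ = _ at h2
    rw [hh, hc, smul_lie, lie_smul, h2, smul_smul, smul_smul, smul_smul] at h1
    have h3 := smul_left_injective ℂ (b.sl2 (π.symm i)).e_ne_zero h1
    have h4 : c i * d i * (2 * c i) = 1 * (2 * c i) := by
      have : c i * d i * (c i * 2) = 2 * c i := by simpa [mul_assoc] using h3
      linear_combination this
    exact mul_right_cancel₀ (mul_ne_zero two_ne_zero (hc0 i)) h4
  -- `τ` permutes the `e i` and `f i` up to the factors `c i` and `d i = (c i)⁻¹`; composing with
  -- `exp (ad z)` removes them and fixes the `h i`.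
  obtain ⟨z, hz⟩ := b.exists_baseSupp_apply_eq fun i ↦ -Complex.log (c (π i))
  have hz1 : ∀ i, Complex.exp (b.baseSupp (π.symm i) z) = (c i)⁻¹ := fun i ↦ by
    rw [hz, Equiv.apply_symm_apply, Complex.exp_neg, Complex.exp_log (hc0 i)]
  have ez : ∀ (y : M) (k : ℂ), ⁅(z : M), y⁆ = k • y → expAd (z : M) y = Complex.exp k • y :=
    fun y k h ↦ Module.End.expEnd_apply_of_eigen (f := LieAlgebra.ad ℂ M (z : M)) h
  refine ⟨π.symm, ((expAd (z : M)).symm.trans w.symm).trans q₀.symm, τ.trans (expAd (z : M)),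
    (((IsQuasiInner.expAd _).symm).trans hw.symm).trans hq₀.symm, fun x ↦ ?_, fun i ↦ ⟨?_, ?_, ?_⟩⟩
  · simp [hτdef]
  · rw [LieEquiv.trans_apply, hh, hcd, one_smul, ez _ 0 (by rw [b.lie_coe_h, zero_smul]),
      Complex.exp_zero, one_smul]
  · rw [LieEquiv.trans_apply, hc]
    refine (map_smul (expAd (z : M)) _ _).trans ?_
    rw [ez _ _ (b.lie_e _ z), hz1, smul_smul, mul_inv_cancel₀ (hc0 i), one_smul]
  · rw [LieEquiv.trans_apply, hd]
    refine (map_smul (expAd (z : M)) _ _).trans ?_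
    rw [ez _ _ (b.lie_f _ z), Complex.exp_neg, hz1, smul_smul, inv_inv, mul_comm, hcd, one_smul]

omit [FiniteDimensional ℂ M] [IsKilling ℂ M] in
lemma cartanMatrix_perm {δ : M ≃ₗ⁅ℂ⁆ M} {π : Equiv.Perm ι}
    (hδ : ∀ i, δ (b.h i) = b.h (π i) ∧ δ (b.e i) = b.e (π i)) (i j : ι) :
    b.A (π i) (π j) = b.A i j := by
  have h1 : ∀ i j, ⁅b.h j, b.e i⁆ = (b.A i j : ℂ) • b.e i := fun i j ↦ by
    rw [← baseSupp_apply_h']; exact b.lie_e i (b.h' j)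
  have h2 := congrArg δ (h1 i j)
  rw [LieEquiv.map_lie, (hδ j).1, (hδ i).2, h1] at h2
  have h3 := h2.trans (map_smul δ _ _)
  rw [(hδ i).2] at h3
  exact_mod_cast smul_left_injective ℂ (b.sl2 _).e_ne_zero h3

end LieAlgebra.Basis

/-! ### Multiplicities and intertwiners for semisimple modules. -/

namespace IsSemisimpleModule

variable {R : Type*} [Ring R] [Algebra ℂ R]

section

variable {V V' W W' : Type*} [AddCommGroup V] [Module ℂ V] [Module R V]
  [IsScalarTower ℂ R V] [AddCommGroup V'] [Module ℂ V'] [Module R V']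
  [IsScalarTower ℂ R V'] [AddCommGroup W] [Module ℂ W] [Module R W]
  [IsScalarTower ℂ R W] [AddCommGroup W'] [Module ℂ W'] [Module R W']
  [IsScalarTower ℂ R W']

lemma finiteDimensional_hom [FiniteDimensional ℂ V] [FiniteDimensional ℂ W] :
    FiniteDimensional ℂ (V →ₗ[R] W) :=
  Module.Finite.of_injective (LinearMap.restrictScalarsₗ ℂ R V W ℂ)
    (LinearMap.restrictScalars_injective ℂ)

/-- The homomorphisms into isomorphic modules are in linear bijection. -/
lemma finrank_hom_congr (e : V ≃ₗ[R] V') (E : Type*) [AddCommGroup E] [Module R E] :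
    Module.finrank ℂ (E →ₗ[R] V) = Module.finrank ℂ (E →ₗ[R] V') := by
  refine LinearEquiv.finrank_eq (M := E →ₗ[R] V) (N := E →ₗ[R] V')
    { toFun := fun f ↦ e.toLinearMap ∘ₗ f
      map_add' := fun f g ↦ by ext; simp
      map_smul' := fun c f ↦ by
        ext x
        exact (e.toLinearMap.restrictScalars ℂ).map_smul c (f x)
      invFun := fun f ↦ e.symm.toLinearMap ∘ₗ f
      left_inv := fun f ↦ by ext; simp
      right_inv := fun f ↦ by ext; simp }

lemma finrank_hom_prod [FiniteDimensional ℂ V] [FiniteDimensional ℂ W]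
    (E : Type*) [AddCommGroup E] [Module ℂ E] [Module R E] [IsScalarTower ℂ R E]
    [FiniteDimensional ℂ E] :
    Module.finrank ℂ (E →ₗ[R] V × W) =
      Module.finrank ℂ (E →ₗ[R] V) + Module.finrank ℂ (E →ₗ[R] W) := by
  have := finiteDimensional_hom (R := R) (V := E) (W := V)
  have := finiteDimensional_hom (R := R) (V := E) (W := W)
  rw [← Module.finrank_prod]
  exact (LinearMap.prodEquiv ℂ (R := R) (M := E) (M₂ := V) (M₃ := W)).finrank_eq.symm

lemma finrank_hom_pi [FiniteDimensional ℂ V] (n : ℕ)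
    (E : Type*) [AddCommGroup E] [Module ℂ E] [Module R E] [IsScalarTower ℂ R E]
    [FiniteDimensional ℂ E] :
    Module.finrank ℂ (E →ₗ[R] Fin n → V) = n * Module.finrank ℂ (E →ₗ[R] V) := by
  have := finiteDimensional_hom (R := R) (V := E) (W := V)
  have h : Module.finrank ℂ (Fin n → (E →ₗ[R] V)) = n * Module.finrank ℂ (E →ₗ[R] V) := by
    rw [Module.finrank_pi_fintype]; simp
  rw [← h]
  refine LinearEquiv.finrank_eq (M := E →ₗ[R] Fin n → V) (N := Fin n → (E →ₗ[R] V))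
    { toFun := fun f i ↦ LinearMap.proj i ∘ₗ f
      map_add' := fun f g ↦ by ext; simp
      map_smul' := fun _ _ ↦ rfl
      invFun := LinearMap.pi
      left_inv := fun f ↦ by ext; simp
      right_inv := fun f ↦ by ext; simp }

lemma finrank_hom_le [FiniteDimensional ℂ V] (E : Type*) [AddCommGroup E] [Module R E]
    [IsSimpleModule R E] : Module.finrank ℂ (E →ₗ[R] V) ≤ Module.finrank ℂ V := by
  have := IsSimpleModule.nontrivial R E
  obtain ⟨x, hx⟩ := exists_ne (0 : E)
  let f : (E →ₗ[R] V) →ₗ[ℂ] V :=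
    { toFun := fun g ↦ g x
      map_add' := fun _ _ ↦ rfl
      map_smul' := fun _ _ ↦ rfl }
  refine LinearMap.finrank_le_finrank_of_injective (f := f) ?_
  rw [← LinearMap.ker_eq_bot, LinearMap.ker_eq_bot']
  intro g hg
  rcases LinearMap.injective_or_eq_zero g with h | h
  · exact absurd (h (hg.trans (map_zero g).symm)) hx
  · exact h

end

/-- Semisimple modules are determined by the dimensions of the spaces of homomorphisms from simple
modules. -/
theorem nonempty_equiv_of_finrank_hom_eq (n : ℕ) (V W : Type u) [AddCommGroup V] [Module ℂ V]
    [Module R V] [IsScalarTower ℂ R V] [AddCommGroup W] [Module ℂ W] [Module R W]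
    [IsScalarTower ℂ R W] [FiniteDimensional ℂ V] [FiniteDimensional ℂ W]
    [IsSemisimpleModule R V] [IsSemisimpleModule R W] (hn : Module.finrank ℂ V = n)
    (h : ∀ (E : Type u) [AddCommGroup E] [Module ℂ E] [Module R E] [IsScalarTower ℂ R E]
      [FiniteDimensional ℂ E] [IsSimpleModule R E],
      Module.finrank ℂ (E →ₗ[R] V) = Module.finrank ℂ (E →ₗ[R] W)) :
    Nonempty (V ≃ₗ[R] W) := by
  induction n using Nat.strong_induction_on generalizing V W with
  | _ n ih =>
  -- A simple submodule of `V` also maps nontrivially to `W`, hence injectively; it can be split off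
  -- both sides.
  have key : ∀ (V W : Type u) [AddCommGroup V] [Module ℂ V]
      [Module R V] [IsScalarTower ℂ R V] [AddCommGroup W] [Module ℂ W] [Module R W]
      [IsScalarTower ℂ R W] [FiniteDimensional ℂ V] [FiniteDimensional ℂ W] (S : Submodule R V),
      IsSimpleModule R S → Module.finrank ℂ (S →ₗ[R] V) = Module.finrank ℂ (S →ₗ[R] W) →
      ∃ f : S →ₗ[R] W, f ≠ 0 := by
    intro V W _ _ _ _ _ _ _ _ _ _ S hS hfr
    have : FiniteDimensional ℂ S := inferInstanceAs (FiniteDimensional ℂ (S.restrictScalars ℂ))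
    have := finiteDimensional_hom (R := R) (V := S) (W := V)
    by_contra! h0
    have : Module.finrank ℂ (S →ₗ[R] W) = 0 :=
      @Module.finrank_zero_of_subsingleton _ _ _ _ _ _ ⟨fun f g ↦ by rw [h0 f, h0 g]⟩
    rw [this, Module.finrank_zero_iff] at hfr
    have h1 : S.subtype = 0 := Subsingleton.elim _ _
    have := IsSimpleModule.nontrivial R S
    obtain ⟨x, hx⟩ := exists_ne (0 : S)
    exact hx (Subtype.ext (LinearMap.congr_fun h1 x))
  rcases subsingleton_or_nontrivial V with hV | hV
  · rcases subsingleton_or_nontrivial W with hW | hW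
    · exact ⟨0⟩
    · obtain ⟨S, hS⟩ := exists_simple_submodule R W
      have : FiniteDimensional ℂ S := inferInstanceAs (FiniteDimensional ℂ (S.restrictScalars ℂ))
      obtain ⟨f, hf⟩ := key W V S hS (h S).symm
      exact absurd (Subsingleton.elim _ _) hf
  · obtain ⟨S, hS⟩ := exists_simple_submodule R V
    have : FiniteDimensional ℂ S := inferInstanceAs (FiniteDimensional ℂ (S.restrictScalars ℂ))
    obtain ⟨f, hf⟩ := key V W S hS (h S)
    have hfi : Function.Injective f := LinearMap.injective_of_ne_zero hf
    obtain ⟨S', hS'⟩ := exists_isCompl S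
    obtain ⟨T', hT'⟩ := exists_isCompl (LinearMap.range f)
    have : FiniteDimensional ℂ S' := inferInstanceAs (FiniteDimensional ℂ (S'.restrictScalars ℂ))
    have : FiniteDimensional ℂ T' := inferInstanceAs (FiniteDimensional ℂ (T'.restrictScalars ℂ))
    let eV : (S × S') ≃ₗ[R] V := S.prodEquivOfIsCompl S' hS'
    let eW : (S × T') ≃ₗ[R] W :=
      ((LinearEquiv.ofInjective f hfi).prodCongr (LinearEquiv.refl R T')).trans
        ((LinearMap.range f).prodEquivOfIsCompl T' hT')
    have hdim : Module.finrank ℂ S' < n := by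
      have h1 := (eV.restrictScalars ℂ).finrank_eq
      rw [Module.finrank_prod, hn] at h1
      have := IsSimpleModule.nontrivial R S
      have : 0 < Module.finrank ℂ S := Module.finrank_pos
      omega
    obtain ⟨e⟩ := ih _ hdim S' T' rfl fun E ↦ by
      intros
      have h1 := h E
      rw [← finrank_hom_congr eV, ← finrank_hom_congr eW, finrank_hom_prod, finrank_hom_prod] at h1
      exact Nat.add_left_cancel h1
    exact ⟨eV.symm.trans (((LinearEquiv.refl R S).prodCongr e).trans eW)⟩

/-- Cancellation for finite-dimensional semisimple modules. -/
theorem nonempty_equiv_of_pi_prod {V V' W W' : Type u} [AddCommGroup V] [Module ℂ V] [Module R V]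
    [IsScalarTower ℂ R V] [AddCommGroup V'] [Module ℂ V'] [Module R V']
    [IsScalarTower ℂ R V'] [AddCommGroup W] [Module ℂ W] [Module R W]
    [IsScalarTower ℂ R W] [AddCommGroup W'] [Module ℂ W'] [Module R W']
    [IsScalarTower ℂ R W'] [FiniteDimensional ℂ V] [FiniteDimensional ℂ W]
    [FiniteDimensional ℂ V'] [FiniteDimensional ℂ W']
    [IsSemisimpleModule R V] [IsSemisimpleModule R W]
    [IsSemisimpleModule R V'] [IsSemisimpleModule R W'] {n : ℕ}
    (hn : Module.finrank ℂ W < n) (hn' : Module.finrank ℂ W' < n)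
    (e : ((Fin n → V) × W) ≃ₗ[R] ((Fin n → V') × W')) :
    Nonempty (V ≃ₗ[R] V') ∧ Nonempty (W ≃ₗ[R] W') := by
  -- `dim Hom(E, Vⁿ ⊕ W) = n · dim Hom(E, V) + dim Hom(E, W)` with last term at most `dim W < n`:
  -- quotient and remainder recover both dimensions.
  have key : ∀ (E : Type u) [AddCommGroup E] [Module ℂ E] [Module R E] [IsScalarTower ℂ R E]
      [FiniteDimensional ℂ E] [IsSimpleModule R E],
      Module.finrank ℂ (E →ₗ[R] V) = Module.finrank ℂ (E →ₗ[R] V') ∧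
      Module.finrank ℂ (E →ₗ[R] W) = Module.finrank ℂ (E →ₗ[R] W') := by
    intro E _ _ _ _ _ _
    have h := finrank_hom_congr e E
    rw [finrank_hom_prod, finrank_hom_prod, finrank_hom_pi, finrank_hom_pi] at h
    have h1 := (finrank_hom_le (R := R) (V := W) E).trans_lt hn
    have h2 := (finrank_hom_le (R := R) (V := W') E).trans_lt hn'
    have h3 : Module.finrank ℂ (E →ₗ[R] V) = Module.finrank ℂ (E →ₗ[R] V') := by
      rcases lt_trichotomy (Module.finrank ℂ (E →ₗ[R] V)) (Module.finrank ℂ (E →ₗ[R] V'))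
        with hlt | heq | hlt
      · have := Nat.mul_le_mul_left n (Nat.succ_le_of_lt hlt)
        rw [Nat.mul_succ] at this
        omega
      · exact heq
      · have := Nat.mul_le_mul_left n (Nat.succ_le_of_lt hlt)
        rw [Nat.mul_succ] at this
        omega
    refine ⟨h3, ?_⟩
    rw [h3] at h
    exact Nat.add_left_cancel h
  exact ⟨nonempty_equiv_of_finrank_hom_eq _ V V' rfl fun E ↦ by intros; exact (key E).1,
    nonempty_equiv_of_finrank_hom_eq _ W W' rfl fun E ↦ by intros; exact (key E).2⟩

/-- Linear automorphisms of the simple submodules of a semisimple module which are semilinear with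
respect to `K` may be glued to one which moreover commutes with all endomorphisms. -/
theorem exists_equiv_commute_end {V : Type*} [AddCommGroup V] [Module ℂ V] [Module R V]
    [IsScalarTower ℂ R V] [FiniteDimensional ℂ V] [IsSemisimpleModule R V] (K : Set (R × R))
    (h : ∀ S : Submodule R V, ∃ A : S ≃ₗ[ℂ] S, ∀ p ∈ K, ∀ s, A (p.1 • s) = p.2 • A s) :
    ∃ A : V ≃ₗ[ℂ] V, (∀ p ∈ K, ∀ v, A (p.1 • v) = p.2 • A v) ∧
      ∀ (T : V →ₗ[R] V) v, A (T v) = T (A v) := by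
  classical
  have : Module.Finite R V := Module.Finite.of_restrictScalars_finite ℂ R V
  obtain ⟨n, S, e₀, hS⟩ := exists_linearEquiv_fin_dfinsupp R V
  let e : V ≃ₗ[R] (∀ i, S i) := e₀.trans DFinsupp.linearEquivFunOnFintype
  choose A₀ hA₀ using fun i ↦ h (S i)
  -- One automorphism is kept for each isomorphism class of simple summands and transported within
  -- the class. By Schur's lemma the result commutes with all homomorphisms between summands.
  let st : Setoid (Fin n) :=
    { r := fun i j ↦ Nonempty (S i ≃ₗ[R] S j)
      iseqv := ⟨fun _ ↦ ⟨LinearEquiv.refl R _⟩, fun ⟨f⟩ ↦ ⟨f.symm⟩, fun ⟨f⟩ ⟨g⟩ ↦ ⟨f.trans g⟩⟩ }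
  have hr : ∀ i, Nonempty (S i ≃ₗ[R] S (Quotient.mk st i).out) := fun i ↦
    st.symm (Quotient.mk_out (s := st) i)
  let r := fun i ↦ (hr i).some
  let A : ∀ i, S i ≃ₗ[ℂ] S i := fun i ↦
    ((r i).restrictScalars ℂ).trans ((A₀ _).trans ((r i).symm.restrictScalars ℂ))
  have hA : ∀ i s, r i (A i s) = A₀ _ (r i s) := fun i s ↦ (r i).apply_symm_apply _
  have hAK : ∀ i, ∀ p ∈ K, ∀ s, A i (p.1 • s) = p.2 • A i s := fun i p hp s ↦ by
    apply (r i).injective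
    rw [hA, map_smul, hA₀ _ p hp, map_smul, hA]
  have hscal : ∀ (q : Fin n) (T : S q →ₗ[R] S q) s, A₀ q (T s) = T (A₀ q s) := fun q T s ↦ by
    have : FiniteDimensional ℂ (S q) :=
      inferInstanceAs (FiniteDimensional ℂ ((S q).restrictScalars ℂ))
    obtain ⟨c, rfl⟩ := (IsSimpleModule.algebraMap_end_bijective_of_isAlgClosed (A := R)
      (V := S q) ℂ).2 T
    simp [Module.algebraMap_end_apply]
  have hAT : ∀ i j (T : S i →ₗ[R] S j) s, A j (T s) = T (A i s) := fun i j T s ↦ by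
    rcases LinearMap.bijective_or_eq_zero T with hT | rfl
    · let t : S i ≃ₗ[R] S j := LinearEquiv.ofBijective T hT
      have hq : Quotient.mk st i = Quotient.mk st j := Quotient.sound ⟨t⟩
      -- The two classes are generalized so that their equality can be substituted into the
      -- dependent types.
      have aux : ∀ (q q' : Quotient st) (_ : q = q') (ri : S i ≃ₗ[R] S q.out)
          (rj : S j ≃ₗ[R] S q'.out), rj.symm (A₀ _ (rj (T s))) = T (ri.symm (A₀ _ (ri s))) := by
        rintro q _ rfl ri rj
        have h1 := hscal q.out (rj.toLinearMap ∘ₗ T ∘ₗ ri.symm.toLinearMap) (ri s)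
        simp only [LinearMap.comp_apply, LinearEquiv.coe_coe, LinearEquiv.symm_apply_apply] at h1
        rw [h1, LinearEquiv.symm_apply_apply]
      exact aux _ _ hq (r i) (r j)
    · simp
  refine ⟨(e.restrictScalars ℂ).trans
    ((LinearEquiv.piCongrRight A).trans (e.symm.restrictScalars ℂ)), fun p hp v ↦ ?_, fun T v ↦ ?_⟩
  · change e.symm (fun i ↦ A i (e (p.1 • v) i)) = p.2 • e.symm (fun i ↦ A i (e v i))
    rw [← map_smul, map_smul]
    congr 1
    funext i
    exact hAK i p hp _
  · change e.symm (fun i ↦ A i (e (T v) i)) = T (e.symm (fun i ↦ A i (e v i)))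
    apply e.injective
    rw [LinearEquiv.apply_symm_apply]
    let M : ∀ i j, S j →ₗ[R] S i := fun i j ↦ LinearMap.proj i ∘ₗ e.toLinearMap ∘ₗ T ∘ₗ
      e.symm.toLinearMap ∘ₗ LinearMap.single R (fun i ↦ S i) j
    have hM : ∀ (w : ∀ i, S i) i, e (T (e.symm w)) i = ∑ j, M i j (w j) := fun w i ↦ by
      conv_lhs => rw [← Finset.univ_sum_single w]
      simp [M, map_sum]
    funext i
    rw [hM]
    conv_lhs => rw [← e.symm_apply_apply v, hM]
    rw [map_sum]
    exact Finset.sum_congr rfl fun j _ ↦ hAT j i _ _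

end IsSemisimpleModule

/-! ### Representations as modules over a free algebra. -/

namespace LieAlgebra

open Module

attribute [local instance] LieRing.ofAssociativeRing

section Transfer

variable {L : Type*}

/-- A family of endomorphisms makes the vector space a module over the free algebra. -/
abbrev freeAlgebraModule {V : Type*} [AddCommGroup V] [Module ℂ V] (ρ : L → Module.End ℂ V) :
    Module (FreeAlgebra ℂ L) V :=
  Module.compHom V (FreeAlgebra.lift ℂ ρ).toRingHom

/-- Two families of operators are isomorphic if an invertible linear map intertwines them. -/
def RepIso {V W : Type*} [AddCommGroup V] [Module ℂ V] [AddCommGroup W] [Module ℂ W]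
    (ρ : L → Module.End ℂ V) (σ : L → Module.End ℂ W) : Prop :=
  ∃ A : V ≃ₗ[ℂ] W, ∀ x v, A (ρ x v) = σ x (A v)

variable {V W : Type*} [AddCommGroup V] [Module ℂ V] [AddCommGroup W] [Module ℂ W]

lemma RepIso.trans {U : Type*} [AddCommGroup U] [Module ℂ U] {ρ : L → Module.End ℂ V}
    {σ : L → Module.End ℂ W} {τ : L → Module.End ℂ U} (h : RepIso ρ σ) (h' : RepIso σ τ) :
    RepIso ρ τ := by
  obtain ⟨A, hA⟩ := h
  obtain ⟨B, hB⟩ := h'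
  exact ⟨A.trans B, fun x v ↦ by simp [hA, hB]⟩

section

variable (ρ : L → Module.End ℂ V)

lemma freeAlgebraModule_ι_smul (x : L) (v : V) :
    letI := freeAlgebraModule ρ
    FreeAlgebra.ι ℂ x • v = ρ x v :=
  congrArg (fun f : Module.End ℂ V ↦ f v) (FreeAlgebra.lift_ι_apply ρ x)

lemma isScalarTower_freeAlgebraModule :
    letI := freeAlgebraModule ρ
    IsScalarTower ℂ (FreeAlgebra ℂ L) V :=
  let := freeAlgebraModule ρ
  ⟨fun c r v ↦ congrArg (fun f : Module.End ℂ V ↦ f v) (map_smul (FreeAlgebra.lift ℂ ρ) c r)⟩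

end

lemma map_freeAlgebra_smul [Module (FreeAlgebra ℂ L) V] [IsScalarTower ℂ (FreeAlgebra ℂ L) V]
    [Module (FreeAlgebra ℂ L) W] [IsScalarTower ℂ (FreeAlgebra ℂ L) W] (f : V →ₗ[ℂ] W)
    (hf : ∀ (x : L) v, f (FreeAlgebra.ι ℂ x • v) = FreeAlgebra.ι ℂ x • f v) (r : FreeAlgebra ℂ L) (v : V) :
    f (r • v) = r • f v := by
  induction r using FreeAlgebra.induction generalizing v with
  | grade0 c => rw [algebraMap_smul, algebraMap_smul, map_smul]
  | grade1 x => exact hf x v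
  | mul a b ha hb => rw [mul_smul, mul_smul, ha, hb]
  | add a b ha hb => rw [add_smul, add_smul, map_add, ha, hb]

end Transfer

variable {L : Type*} [LieRing L] [LieAlgebra ℂ L]

section

variable [FiniteDimensional ℂ L] [IsKilling ℂ L]

/-- Submodules over the free algebra are exactly the subrepresentations, so Weyl's theorem applies.
-/
lemma isSemisimpleModule_freeAlgebra {V : Type*} [AddCommGroup V] [Module ℂ V]
    [FiniteDimensional ℂ V] (ρ : L →ₗ⁅ℂ⁆ Module.End ℂ V) :
    letI := freeAlgebraModule ρ
    IsSemisimpleModule (FreeAlgebra ℂ L) V := by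
  let := freeAlgebraModule ρ
  have := isScalarTower_freeAlgebraModule ρ
  let : LieRingModule L V := LieRingModule.compLieHom V ρ
  let : LieModule ℂ L V := LieModule.compLieHom V ρ
  refine @IsSemisimpleModule.mk _ _ _ _ _ ⟨fun p ↦ ?_⟩
  let W : LieSubmodule ℂ L V :=
    { p.restrictScalars ℂ with
      lie_mem := fun {x m} hm ↦ by
        have := p.smul_mem (FreeAlgebra.ι ℂ x) hm
        rw [freeAlgebraModule_ι_smul] at this
        exact this }
  obtain ⟨W', hW'⟩ := IsKilling.exists_isCompl_lieSubmodule W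
  let q : Submodule (FreeAlgebra ℂ L) V :=
    { W'.toSubmodule with
      smul_mem' := fun r v hv ↦ by
        have h : ∀ r : FreeAlgebra ℂ L, ∀ v ∈ W', r • v ∈ W' := fun r ↦ by
          induction r using FreeAlgebra.induction with
          | grade0 c => intro v hv; rw [algebraMap_smul]; exact W'.smul_mem c hv
          | grade1 x => intro v hv; rw [freeAlgebraModule_ι_smul]; exact W'.lie_mem hv
          | mul a b ha hb => intro v hv; rw [mul_smul]; exact ha _ (hb _ hv)
          | add a b ha hb => intro v hv; rw [add_smul]; exact add_mem (ha _ hv) (hb _ hv)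
        exact h r v hv }
  refine ⟨q, ?_, ?_⟩
  · rw [Submodule.disjoint_def]
    exact fun v hv hv' ↦ Submodule.disjoint_def.mp hW'.disjoint v hv hv'
  · rw [codisjoint_iff, eq_top_iff]
    intro v _
    have : v ∈ W.toSubmodule ⊔ W'.toSubmodule := by rw [hW'.sup_eq_top]; trivial
    obtain ⟨a, ha, b, hb, rfl⟩ := Submodule.mem_sup.mp this
    exact Submodule.add_mem_sup (show a ∈ p from ha) (show b ∈ q from hb)

end

/-- The direct sum of `n` copies of a representation and another one. -/
def piProdRep {V W : Type*} [AddCommGroup V] [Module ℂ V] [AddCommGroup W] [Module ℂ W] (n : ℕ)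
    (ρ : L →ₗ⁅ℂ⁆ Module.End ℂ V) (σ : L →ₗ⁅ℂ⁆ Module.End ℂ W) :
    L →ₗ⁅ℂ⁆ Module.End ℂ ((Fin n → V) × W) where
  toFun x := (LinearMap.pi fun i ↦ ρ x ∘ₗ LinearMap.proj i).prodMap (σ x)
  map_add' x y := by ext <;> simp
  map_smul' c x := by ext <;> simp
  map_lie' {x y} := by ext <;> simp [LieRing.of_associative_ring_bracket]

variable [FiniteDimensional ℂ L] [IsKilling ℂ L]

/-- Cancellation for finite-dimensional representations of semisimple Lie algebras. -/
lemma RepIso.of_piProdRep {V V' W W' : Type u} [AddCommGroup V] [Module ℂ V]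
    [AddCommGroup V'] [Module ℂ V'] [AddCommGroup W] [Module ℂ W] [AddCommGroup W'] [Module ℂ W']
    [FiniteDimensional ℂ V] [FiniteDimensional ℂ V'] [FiniteDimensional ℂ W]
    [FiniteDimensional ℂ W'] (ρ : L →ₗ⁅ℂ⁆ Module.End ℂ V) (ρ' : L →ₗ⁅ℂ⁆ Module.End ℂ V')
    (σ : L →ₗ⁅ℂ⁆ Module.End ℂ W) (σ' : L →ₗ⁅ℂ⁆ Module.End ℂ W') {n : ℕ}
    (hn : finrank ℂ W < n) (hn' : finrank ℂ W' < n)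
    (h : RepIso (piProdRep n ρ σ) (piProdRep n ρ' σ')) : RepIso ρ ρ' ∧ RepIso σ σ' := by
  let := freeAlgebraModule ρ
  let := freeAlgebraModule ρ'
  let := freeAlgebraModule σ
  let := freeAlgebraModule σ'
  have := isScalarTower_freeAlgebraModule ρ
  have := isScalarTower_freeAlgebraModule ρ'
  have := isScalarTower_freeAlgebraModule σ
  have := isScalarTower_freeAlgebraModule σ'
  have := isSemisimpleModule_freeAlgebra ρ
  have := isSemisimpleModule_freeAlgebra ρ'
  have := isSemisimpleModule_freeAlgebra σ
  have := isSemisimpleModule_freeAlgebra σ'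
  obtain ⟨A, hA⟩ := h
  let e : ((Fin n → V) × W) ≃ₗ[FreeAlgebra ℂ L] ((Fin n → V') × W') :=
    { A with
      map_smul' := map_freeAlgebra_smul A.toLinearMap fun x v ↦ by
        have h1 : FreeAlgebra.ι ℂ x • v = piProdRep n ρ σ x v := Prod.ext
          (funext fun i ↦ freeAlgebraModule_ι_smul ρ x (v.1 i)) (freeAlgebraModule_ι_smul σ x v.2)
        have h2 : ∀ v, FreeAlgebra.ι ℂ x • v = piProdRep n ρ' σ' x v := fun v ↦ Prod.ext
          (funext fun i ↦ freeAlgebraModule_ι_smul ρ' x (v.1 i))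
          (freeAlgebraModule_ι_smul σ' x v.2)
        rw [h1, h2]
        exact hA x v }
  obtain ⟨⟨f⟩, ⟨g⟩⟩ := IsSemisimpleModule.nonempty_equiv_of_pi_prod hn hn' e
  refine ⟨⟨f.restrictScalars ℂ, fun x v ↦ ?_⟩, ⟨g.restrictScalars ℂ, fun x v ↦ ?_⟩⟩
  · have := map_smul f (FreeAlgebra.ι ℂ x) v
    rwa [freeAlgebraModule_ι_smul, freeAlgebraModule_ι_smul] at this
  · have := map_smul g (FreeAlgebra.ι ℂ x) v
    rwa [freeAlgebraModule_ι_smul, freeAlgebraModule_ι_smul] at this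

/-- If all representations of `L` are isomorphic to their twists along a map `φ` on a subset `s`,
then the intertwiner may be chosen to commute with the commutant of the representation. -/
theorem exists_equiv_commute {L : Type u} [LieRing L] [LieAlgebra ℂ L] [FiniteDimensional ℂ L]
    [IsKilling ℂ L] {ι : Type*} (s t : ι → L)
    (h : ∀ (V : Type u) [AddCommGroup V] [Module ℂ V] [FiniteDimensional ℂ V]
      (ρ : L →ₗ⁅ℂ⁆ Module.End ℂ V), RepIso (fun i ↦ ρ (s i)) (fun i ↦ ρ (t i)))
    (V : Type u) [AddCommGroup V] [Module ℂ V] [FiniteDimensional ℂ V]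
    (ρ : L →ₗ⁅ℂ⁆ Module.End ℂ V) :
    ∃ A : V ≃ₗ[ℂ] V, (∀ i v, A (ρ (s i) v) = ρ (t i) (A v)) ∧
      ∀ B : Module.End ℂ V, (∀ x v, B (ρ x v) = ρ x (B v)) → ∀ v, A (B v) = B (A v) := by
  let := freeAlgebraModule ρ
  have := isScalarTower_freeAlgebraModule ρ
  have := isSemisimpleModule_freeAlgebra ρ
  obtain ⟨A, hA, hA'⟩ := IsSemisimpleModule.exists_equiv_commute_end
    (Set.range fun i ↦ (FreeAlgebra.ι ℂ (s i), FreeAlgebra.ι ℂ (t i))) (fun S : Submodule _ V ↦ by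
      have : FiniteDimensional ℂ S := inferInstanceAs (FiniteDimensional ℂ (S.restrictScalars ℂ))
      have hinv : ∀ x, ∀ v ∈ S.restrictScalars ℂ, ρ x v ∈ S.restrictScalars ℂ := fun x v hv ↦ by
        rw [← freeAlgebraModule_ι_smul]
        exact S.smul_mem _ hv
      let τ : L →ₗ⁅ℂ⁆ Module.End ℂ (S.restrictScalars ℂ) :=
        { toFun := fun x ↦ (ρ x).restrict (hinv x)
          map_add' := fun x y ↦ LinearMap.ext fun v ↦ Subtype.ext (by simp)
          map_smul' := fun c x ↦ LinearMap.ext fun v ↦ Subtype.ext (by simp)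
          map_lie' := fun {x y} ↦ LinearMap.ext fun v ↦ Subtype.ext (by
            simp [LieRing.of_associative_ring_bracket]) }
      have hτ : ∀ x (v : S), FreeAlgebra.ι ℂ x • v = τ x v := fun x v ↦
        Subtype.ext (freeAlgebraModule_ι_smul ρ x (v : V))
      obtain ⟨A, hA⟩ := h (S.restrictScalars ℂ) τ
      refine ⟨A, ?_⟩
      rintro _ ⟨i, rfl⟩ v
      simp only [hτ]
      exact hA i v)
  refine ⟨A, fun i v ↦ ?_, fun B hB v ↦ ?_⟩
  · have := hA _ ⟨i, rfl⟩ v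
    rwa [freeAlgebraModule_ι_smul, freeAlgebraModule_ι_smul] at this
  · exact hA' { B with
      map_smul' := map_freeAlgebra_smul B fun x v ↦ by
        rw [freeAlgebraModule_ι_smul, freeAlgebraModule_ι_smul]
        exact hB x v } v

end LieAlgebra

/-! ### One isomorphism for all representations. -/

namespace LieAlgebra

open Module

attribute [local instance] LieRing.ofAssociativeRing

/-- Homomorphisms which agree on the generators are equal. -/
lemma Basis.hom_ext {ι L L' : Type*} [Finite ι] [LieRing L] [LieAlgebra ℂ L] [LieRing L']
    [LieAlgebra ℂ L'] {H : LieSubalgebra ℂ L} (b : LieAlgebra.Basis ι H) {f g : L →ₗ⁅ℂ⁆ L'}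
    (he : ∀ i, f (b.e i) = g (b.e i)) (hf : ∀ i, f (b.f i) = g (b.f i)) (x : L) : f x = g x := by
  have hx : x ∈ LieSubalgebra.lieSpan ℂ L (Set.range b.e ∪ Set.range b.f) := by simp [b.span_ef]
  induction hx using LieSubalgebra.lieSpan_induction with
  | mem x hx =>
    obtain ⟨i, rfl⟩ | ⟨i, rfl⟩ := hx
    exacts [he i, hf i]
  | zero => simp
  | add x y _ _ hx hy => rw [map_add, map_add, hx, hy]
  | smul c x _ hx => rw [map_smul, map_smul, hx]
  | lie x y _ _ hx hy => rw [LieHom.map_lie, LieHom.map_lie, hx, hy]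

/-- The automorphism permutes the canonical generators. -/
def Basis.IsPermutation {ι L : Type*} [Finite ι] [LieRing L] [LieAlgebra ℂ L]
    {H : LieSubalgebra ℂ L} (b : LieAlgebra.Basis ι H) (δ : L ≃ₗ⁅ℂ⁆ L) : Prop :=
  ∃ π : Equiv.Perm ι,
    ∀ i, δ (b.h i) = b.h (π i) ∧ δ (b.e i) = b.e (π i) ∧ δ (b.f i) = b.f (π i)

lemma Basis.finite_isPermutation {ι L : Type*} [Finite ι] [LieRing L] [LieAlgebra ℂ L]
    {H : LieSubalgebra ℂ L} (b : LieAlgebra.Basis ι H) : {δ | b.IsPermutation δ}.Finite := by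
  classical
  choose! p hp using fun (δ : L ≃ₗ⁅ℂ⁆ L) (hδ : b.IsPermutation δ) ↦ hδ
  refine Set.Finite.of_injOn (f := p) (t := Set.univ) (fun _ _ ↦ trivial) ?_ Set.finite_univ
  intro δ hδ δ' hδ' h
  refine LieEquiv.ext fun x ↦ b.hom_ext (f := δ.toLieHom) (g := δ'.toLieHom) (fun i ↦ ?_)
    (fun i ↦ ?_) x
  · exact (hp δ hδ i).2.1.trans ((congrArg (fun q ↦ b.e (q i)) h).trans (hp δ' hδ' i).2.1.symm)
  · exact (hp δ hδ i).2.2.trans ((congrArg (fun q ↦ b.f (q i)) h).trans (hp δ' hδ' i).2.2.symm)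

variable {J : Type u} [LieRing J] [LieAlgebra ℂ J] {S M : LieSubalgebra ℂ J}

/-- Conjugation carries `ρ(S)` onto `ρ(M)`, and faithfulness pulls it back to an isomorphism `S →
M`, which still depends on `ρ`. -/
lemma exists_equiv_repIso_of_injective {V : Type u} [AddCommGroup V] [Module ℂ V]
    [FiniteDimensional ℂ V] (h : SemisimpleSubalgebras.LinearlyEquivalent S M)
    (ρ : J →ₗ⁅ℂ⁆ Module.End ℂ V) (hρ : Function.Injective ρ) :
    ∃ φ : S ≃ₗ⁅ℂ⁆ M, RepIso (fun x : S ↦ ρ x) (fun x : S ↦ ρ (φ x)) := by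
  obtain ⟨a, ha⟩ := h V ρ
  have h1 : ∀ x : S, ∃ y : M, ρ y = a.lieConj (ρ x) := fun x ↦ by
    have : a.lieConj (ρ x) ∈ M.map ρ := by
      rw [← ha]
      exact ⟨ρ x, ⟨x, x.2, rfl⟩, rfl⟩
    obtain ⟨y, hy, e⟩ := this
    exact ⟨⟨y, hy⟩, e⟩
  choose f hf using h1
  let φ : S →ₗ⁅ℂ⁆ M :=
    { toFun := f
      map_add' := fun x y ↦ Subtype.ext (hρ (by simp [hf]))
      map_smul' := fun c x ↦ Subtype.ext (hρ (by simp [hf]))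
      map_lie' := fun {x y} ↦ Subtype.ext (hρ (by
        rw [hf, LieSubalgebra.coe_bracket, LieSubalgebra.coe_bracket, LieHom.map_lie,
          LieHom.map_lie, LieEquiv.map_lie, hf, hf])) }
  have hφ : Function.Bijective φ := by
    refine ⟨fun x y hxy ↦ ?_, fun y ↦ ?_⟩
    · have := congrArg (fun z : M ↦ ρ z) (show f x = f y from hxy)
      simp only [hf] at this
      exact Subtype.ext (hρ (a.lieConj.injective this))
    · have : ρ y ∈ (S.map ρ).map (a.lieConj : Module.End ℂ V →ₗ⁅ℂ⁆ Module.End ℂ V) := by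
        rw [ha]; exact ⟨y, y.2, rfl⟩
      obtain ⟨_, ⟨x, hx, rfl⟩, e⟩ := this
      exact ⟨⟨x, hx⟩, Subtype.ext (hρ ((hf ⟨x, hx⟩).trans e))⟩
  refine ⟨LieEquiv.ofBijective φ hφ, a, fun x v ↦ ?_⟩
  have : ρ (f x) (a v) = a.lieConj (ρ x) (a v) := by rw [hf]
  refine Eq.trans ?_ this.symm
  simp [LinearEquiv.lieConj_apply, LinearEquiv.conj_apply]

variable [FiniteDimensional ℂ J] [IsKilling ℂ J]

lemma ad_injective_of_isKilling : Function.Injective (LieAlgebra.ad ℂ J) := by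
  rw [← LieHom.ker_eq_bot, LieAlgebra.ad_ker_eq_self_module_ker]
  simp

/-- Linearly equivalent semisimple subalgebras admit an isomorphism which induces isomorphisms
between the restrictions of all representations simultaneously. -/
theorem exists_equiv_repIso {ι : Type*} [Fintype ι] [IsKilling ℂ S] [IsKilling ℂ M]
    {H : LieSubalgebra ℂ M}
    (b : LieAlgebra.Basis ι H) (h : SemisimpleSubalgebras.LinearlyEquivalent S M) :
    ∃ φ : S ≃ₗ⁅ℂ⁆ M, ∀ (V : Type u) [AddCommGroup V] [Module ℂ V] [FiniteDimensional ℂ V]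
      (ρ : J →ₗ⁅ℂ⁆ Module.End ℂ V), RepIso (fun x : S ↦ ρ x) (fun x : S ↦ ρ (φ x)) := by
  obtain ⟨φ₀, -⟩ := exists_equiv_repIso_of_injective h (LieAlgebra.ad ℂ J) ad_injective_of_isKilling
  -- The permutation automorphisms `δ` for which `δ ∘ φ₀` serves `ρ`. For faithful `ρ` some exist,
  -- since a quasi-inner factor can be absorbed into the intertwiner.
  let P (V : Type u) [AddCommGroup V] [Module ℂ V] (ρ : J →ₗ⁅ℂ⁆ Module.End ℂ V) :
      Set (M ≃ₗ⁅ℂ⁆ M) :=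
    {δ | b.IsPermutation δ ∧ RepIso (fun x : S ↦ ρ x) (fun x : S ↦ ρ (δ (φ₀ x)))}
  have hfin : ∀ (V : Type u) [AddCommGroup V] [Module ℂ V] (ρ : J →ₗ⁅ℂ⁆ Module.End ℂ V),
      (P V ρ).Finite := fun V _ _ ρ ↦ b.finite_isPermutation.subset fun δ hδ ↦ hδ.1
  have hne : ∀ (V : Type u) [AddCommGroup V] [Module ℂ V] [FiniteDimensional ℂ V]
      (ρ : J →ₗ⁅ℂ⁆ Module.End ℂ V), Function.Injective ρ → (P V ρ).Nonempty := by
    intro V _ _ _ ρ hρ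
    obtain ⟨φ, A, hA⟩ := exists_equiv_repIso_of_injective h ρ hρ
    obtain ⟨π, q, δ, hq, hqδ, hδ⟩ := b.exists_isQuasiInner_mul_perm (φ₀.symm.trans φ)
    obtain ⟨B, hB, -⟩ := hq V (ρ.comp M.incl)
    refine ⟨δ, ⟨π, hδ⟩, A.trans B.symm, fun x v ↦ B.injective ?_⟩
    have h1 : φ x = q (δ (φ₀ x)) := by
      rw [← hqδ, LieEquiv.trans_apply, LieEquiv.symm_apply_apply]
    have h2 := hB (δ (φ₀ x)) (B.symm (A v))
    rw [B.apply_symm_apply, ← h1] at h2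
    rw [LinearEquiv.trans_apply, B.apply_symm_apply, hA]
    exact h2.symm
  have hex : ∃ n : ℕ, ∃ (V : Type u) (_ : AddCommGroup V) (_ : Module ℂ V)
      (_ : FiniteDimensional ℂ V) (ρ : J →ₗ⁅ℂ⁆ Module.End ℂ V), Function.Injective ρ ∧
      (P V ρ).ncard = n :=
    ⟨_, J, inferInstance, inferInstance, inferInstance, LieAlgebra.ad ℂ J,
      ad_injective_of_isKilling, rfl⟩
  classical
  -- Take `ρ` faithful with `P V ρ` smallest. For `τ = ρⁿ ⊕ σ` with `n > dim σ`, cancellation puts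
  -- the set of `τ` inside those of `ρ` and `σ`. By minimality it is all of `P V ρ`, so one `δ`
  -- serves every `σ`.
  obtain ⟨V, _, _, _, ρ, hρ, hn⟩ := Nat.find_spec hex
  obtain ⟨δ, hδ⟩ := hne V ρ hρ
  refine ⟨φ₀.trans δ, fun W _ _ _ σ ↦ ?_⟩
  let n := finrank ℂ W + 1
  let τ := piProdRep n ρ σ
  have hτ : Function.Injective τ := by
    intro x y hxy
    refine hρ (LinearMap.ext fun v ↦ ?_)
    have := congrFun (congrArg Prod.fst (LinearMap.congr_fun hxy (fun _ ↦ v, 0))) 0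
    exact this
  have hsub : ∀ δ ∈ P _ τ, δ ∈ P V ρ ∧ δ ∈ P W σ := by
    intro δ hδ
    let f : S →ₗ⁅ℂ⁆ J := M.incl.comp (δ.toLieHom.comp φ₀.toLieHom)
    obtain ⟨h1, h2⟩ := RepIso.of_piProdRep (ρ.comp S.incl) (ρ.comp f) (σ.comp S.incl) (σ.comp f)
      (n := n) (Nat.lt_succ_self _) (Nat.lt_succ_self _) hδ.2
    exact ⟨⟨hδ.1, h1⟩, ⟨hδ.1, h2⟩⟩
  have heq : P _ τ = P V ρ := by
    refine Set.eq_of_subset_of_ncard_le (fun δ hδ ↦ (hsub δ hδ).1) ?_ (hfin V ρ)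
    rw [hn]
    exact Nat.find_min' hex ⟨_, inferInstance, inferInstance, inferInstance, τ, hτ, rfl⟩
  exact (hsub δ (heq ▸ hδ)).2.2

end LieAlgebra

/-! ### Ideals, quotients and commuting homomorphisms. -/

namespace LieAlgebra

open Module

attribute [local instance] LieRing.ofAssociativeRing

section

variable {K L L' : Type*} [Field K] [LieRing L] [LieAlgebra K L] [LieRing L'] [LieAlgebra K L']

lemma lie_eq_zero_of_disjoint {I J : LieIdeal K L} (h : Disjoint I J) {x y : L} (hx : x ∈ I)
    (hy : y ∈ J) : ⁅x, y⁆ = 0 := by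
  have h1 : ⁅x, y⁆ ∈ I ⊓ J := ⟨lie_mem_left K L I x y hx, lie_mem_right K L J x y hy⟩
  rwa [h.eq_bot, LieSubmodule.mem_bot] at h1

/-- The projection onto an ideal along a complementary ideal is a homomorphism. -/
lemma exists_projection {I J : LieIdeal K L} (h : IsCompl I J) :
    ∃ p : L →ₗ⁅K⁆ I, (∀ x : I, p x = x) ∧ (∀ x ∈ J, p x = 0) ∧ ∀ x, x - p x ∈ J := by
  have hc : IsCompl I.toSubmodule J.toSubmodule := LieSubmodule.isCompl_toSubmodule.mpr h
  let p : L →ₗ[K] I := I.toSubmodule.projectionOnto J.toSubmodule hc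
  have h1 : ∀ x : I, p x = x := Submodule.projectionOnto_apply_left hc
  have h2 : ∀ x, p x = 0 ↔ x ∈ J := fun _ ↦ Submodule.projectionOnto_apply_eq_zero_iff hc
  have h3 : ∀ x, x - p x ∈ J := fun x ↦ by rw [← h2, map_sub, h1, sub_self]
  refine ⟨{ p with map_lie' := fun {x y} ↦ ?_ }, h1, fun x ↦ (h2 x).mpr, h3⟩
  change p ⁅x, y⁆ = ⁅p x, p y⁆
  have h4 : ⁅x, y⁆ = ((⁅p x, p y⁆ : I) : L) + ⁅x - p x, y - p y⁆ := by
    have e1 : ⁅(p x : L), y - p y⁆ = 0 := lie_eq_zero_of_disjoint h.disjoint (p x).2 (h3 y)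
    have e2 : ⁅x - p x, (p y : L)⁆ = 0 := lie_eq_zero_of_disjoint h.disjoint.symm (h3 x) (p y).2
    rw [lie_sub] at e1
    rw [sub_lie] at e2
    change ⁅x, y⁆ = ⁅(p x : L), (p y : L)⁆ + _
    rw [sub_lie, lie_sub, lie_sub, sub_eq_zero.mp e1, sub_eq_zero.mp e2]
    abel
  rw [h4, map_add, h1, (h2 _).mpr (lie_mem_left K L J _ _ (h3 x)), add_zero]

variable [FiniteDimensional K L] [IsKilling K L]

/-- A quotient of a semisimple Lie algebra is semisimple. -/
lemma isKilling_of_surjective [CharZero K] [FiniteDimensional K L'] (f : L →ₗ⁅K⁆ L')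
    (hf : Function.Surjective f) : IsKilling K L' := by
  have : HasTrivialRadical K L' := by
    rw [hasTrivialRadical_iff_no_abelian_ideals]
    intro A hA
    have hc := f.ker.isCompl_killingCompl
    -- Brackets in `B` lie both in the kernel and in its complement, so `B` is abelian and vanishes;
    -- yet it maps onto `A`.
    let B : LieIdeal K L := A.comap f ⊓ f.ker.killingCompl
    have hB : IsLieAbelian B := ⟨fun x y ↦ by
      refine Subtype.ext ?_
      have h1 : ⁅(x : L), (y : L)⁆ ∈ f.ker := by
        rw [LieHom.mem_ker, LieHom.map_lie]
        exact congrArg Subtype.val (hA.trivial ⟨f x, x.2.1⟩ ⟨f y, y.2.1⟩)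
      have h2 : ⁅(x : L), (y : L)⁆ ∈ f.ker ⊓ f.ker.killingCompl :=
        ⟨h1, lie_mem_right K L _ _ _ y.2.2⟩
      rwa [hc.inf_eq_bot, LieSubmodule.mem_bot] at h2⟩
    have hB0 : B = ⊥ := IsKilling.ideal_eq_bot_of_isLieAbelian B
    rw [LieSubmodule.eq_bot_iff]
    intro y hy
    obtain ⟨x, rfl⟩ := hf y
    have hx : x ∈ f.ker ⊔ f.ker.killingCompl := by rw [hc.sup_eq_top]; trivial
    obtain ⟨n, hn, c, hc', rfl⟩ := (LieSubmodule.mem_sup _ _ _).mp hx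
    have hn' : f n = 0 := hn
    rw [map_add, hn', zero_add] at hy ⊢
    have : c ∈ B := ⟨hy, hc'⟩
    rw [hB0, LieSubmodule.mem_bot] at this
    rw [this, map_zero]
  infer_instance

lemma isKilling_lieIdeal [CharZero K] (I : LieIdeal K L) : IsKilling K I := by
  obtain ⟨p, hp, -⟩ := exists_projection I.isCompl_killingCompl
  exact isKilling_of_surjective p fun x ↦ ⟨x, hp x⟩

end

section

variable {L L' : Type*} [LieRing L] [LieAlgebra ℂ L] [LieRing L'] [LieAlgebra ℂ L']

/-- The sum of two homomorphisms with commuting images. -/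
def addOfCommute (f h : L →ₗ⁅ℂ⁆ L') (hc : ∀ x y, ⁅f x, h y⁆ = 0) : L →ₗ⁅ℂ⁆ L' where
  __ := (f : L →ₗ[ℂ] L') + (h : L →ₗ[ℂ] L')
  map_lie' {x y} := by
    change f ⁅x, y⁆ + h ⁅x, y⁆ = ⁅f x + h x, f y + h y⁆
    have h1 : ⁅h x, f y⁆ = 0 := by rw [← lie_skew, hc, neg_zero]
    rw [add_lie, lie_add, lie_add, hc, h1, LieHom.map_lie, LieHom.map_lie, add_zero, zero_add]

/-- A homomorphism maps into every subalgebra which contains the images of the generators. -/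
lemma Basis.map_mem {ι : Type*} [Finite ι] {H : LieSubalgebra ℂ L} (b : LieAlgebra.Basis ι H)
    (f : L →ₗ⁅ℂ⁆ L') (T : LieSubalgebra ℂ L') (he : ∀ i, f (b.e i) ∈ T) (hf : ∀ i, f (b.f i) ∈ T)
    (x : L) : f x ∈ T := by
  have h : LieSubalgebra.lieSpan ℂ L (Set.range b.e ∪ Set.range b.f) ≤ T.comap f := by
    rw [LieSubalgebra.lieSpan_le]
    rintro _ (⟨i, rfl⟩ | ⟨i, rfl⟩)
    exacts [he i, hf i]
  rw [b.span_ef] at h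
  exact h (LieSubalgebra.mem_top x)

end

section

variable {g : Type u} [LieRing g] [LieAlgebra ℂ g]

/-- The intertwiner itself conjugates the images. This reduces the theorem to deforming the
inclusion of `S` into a homomorphism onto a glued algebra. -/
lemma linearlyEquivalent_range (S : LieSubalgebra ℂ g) (Ψ : S →ₗ⁅ℂ⁆ g)
    (h : ∀ (V : Type u) [AddCommGroup V] [Module ℂ V] [FiniteDimensional ℂ V]
      (ρ : g →ₗ⁅ℂ⁆ Module.End ℂ V), RepIso (fun x : S ↦ ρ x) (fun x : S ↦ ρ (Ψ x))) :
    SemisimpleSubalgebras.LinearlyEquivalent S Ψ.range := by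
  intro V _ _ _ ρ
  obtain ⟨A, hA⟩ := h V ρ
  have h1 : ∀ x : S, A.lieConj (ρ x) = ρ (Ψ x) := fun x ↦ LinearMap.ext fun v ↦ by
    have := hA x (A.symm v)
    rw [A.apply_symm_apply] at this
    simpa [LinearEquiv.lieConj_apply, LinearEquiv.conj_apply] using this
  refine ⟨A, le_antisymm ?_ ?_⟩
  · rintro _ ⟨_, ⟨x, hx, rfl⟩, rfl⟩
    exact ⟨Ψ ⟨x, hx⟩, ⟨⟨x, hx⟩, rfl⟩, (h1 ⟨x, hx⟩).symm⟩
  · rintro _ ⟨_, ⟨x, rfl⟩, rfl⟩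
    exact ⟨ρ x, ⟨x, x.2, rfl⟩, h1 x⟩

/-- Twisting by a quasi-inner automorphism of a subalgebra does not change representations. -/
lemma IsQuasiInner.repIso {X : Type*} {B : Type u} [LieRing B] [LieAlgebra ℂ B] {q : B ≃ₗ⁅ℂ⁆ B}
    (hq : IsQuasiInner q) (F : B →ₗ⁅ℂ⁆ g) (y : X → B) (z : X → g)
    (hz : ∀ x b, ⁅z x, F b⁆ = 0) (V : Type u) [AddCommGroup V] [Module ℂ V]
    [FiniteDimensional ℂ V] (ρ : g →ₗ⁅ℂ⁆ Module.End ℂ V) :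
    RepIso (fun x ↦ ρ (z x + F (y x))) (fun x ↦ ρ (z x + F (q (y x)))) := by
  obtain ⟨A, hA, hA'⟩ := hq V (ρ.comp F)
  refine ⟨A, fun x v ↦ ?_⟩
  have h1 : A (ρ (z x) v) = ρ (z x) (A v) := hA' (ρ (z x)) (fun b w ↦ by
    have h2 : ⁅ρ (z x), ρ (F b)⁆ = 0 := by rw [← LieHom.map_lie, hz, map_zero]
    have h3 := LinearMap.congr_fun h2 w
    rw [LieRing.of_associative_ring_bracket] at h3
    exact sub_eq_zero.mp h3) v
  have h2 : A (ρ (F (y x)) v) = ρ (F (q (y x))) (A v) := hA (y x) v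
  simp only [map_add, LinearMap.add_apply, h1, h2]

/-- Simultaneous isomorphisms of representations of two commuting ideals may be combined. -/
lemma repIso_add {X : Type*} [FiniteDimensional ℂ g] {I₁ I₂ : LieIdeal ℂ g} [IsKilling ℂ I₁]
    [IsKilling ℂ I₂] (hI : Disjoint I₁ I₂) (s₁ t₁ : X → I₁) (s₂ t₂ : X → I₂)
    (h₁ : ∀ (V : Type u) [AddCommGroup V] [Module ℂ V] [FiniteDimensional ℂ V]
      (ρ : I₁ →ₗ⁅ℂ⁆ Module.End ℂ V), RepIso (fun x ↦ ρ (s₁ x)) (fun x ↦ ρ (t₁ x)))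
    (h₂ : ∀ (V : Type u) [AddCommGroup V] [Module ℂ V] [FiniteDimensional ℂ V]
      (ρ : I₂ →ₗ⁅ℂ⁆ Module.End ℂ V), RepIso (fun x ↦ ρ (s₂ x)) (fun x ↦ ρ (t₂ x)))
    (V : Type u) [AddCommGroup V] [Module ℂ V] [FiniteDimensional ℂ V]
    (ρ : g →ₗ⁅ℂ⁆ Module.End ℂ V) :
    RepIso (fun x ↦ ρ (s₁ x + s₂ x)) (fun x ↦ ρ (t₁ x + t₂ x)) := by
  have hcomm : ∀ (a : I₁) (b : I₂) v, ρ a (ρ b v) = ρ b (ρ a v) := fun a b v ↦ by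
    have h2 : ⁅ρ a, ρ b⁆ = 0 := by
      rw [← LieHom.map_lie, lie_eq_zero_of_disjoint hI a.2 b.2, map_zero]
    have h3 := LinearMap.congr_fun h2 v
    rw [LieRing.of_associative_ring_bracket] at h3
    exact sub_eq_zero.mp h3
  -- `A` commutes with the commutant of `ρ(I₁)`, which contains `ρ(I₂)`, and `B` symmetrically, so
  -- the composite treats both summands.
  obtain ⟨A, hA, hA'⟩ := exists_equiv_commute s₁ t₁ h₁ V (ρ.comp I₁.incl)
  obtain ⟨B, hB, hB'⟩ := exists_equiv_commute s₂ t₂ h₂ V (ρ.comp I₂.incl)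
  refine ⟨A.trans B, fun x v ↦ ?_⟩
  have e1 : A (ρ (s₁ x) v) = ρ (t₁ x) (A v) := hA x v
  have e2 : A (ρ (s₂ x) v) = ρ (s₂ x) (A v) :=
    hA' (ρ (s₂ x)) (fun a w ↦ (hcomm a (s₂ x) w).symm) v
  have e3 : B (ρ (s₂ x) (A v)) = ρ (t₂ x) (B (A v)) := hB x (A v)
  have e4 : B (ρ (t₁ x) (A v)) = ρ (t₁ x) (B (A v)) :=
    hB' (ρ (t₁ x)) (fun b w ↦ hcomm (t₁ x) b w) (A v)
  simp only [map_add, LinearMap.add_apply, LinearEquiv.trans_apply, e1, e2, e3, e4]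

end

end LieAlgebra

/-! ### Gluing the images of the two projections. -/

namespace SemisimpleSubalgebras

open LieAlgebra

attribute [local instance] LieRing.ofAssociativeRing

section

variable {J S : Type u} [LieRing J] [LieAlgebra ℂ J] [FiniteDimensional ℂ J] [LieRing S]
  [LieAlgebra ℂ S] [FiniteDimensional ℂ S] [IsKilling ℂ S]

/-- Up to isomorphism of all representations, a homomorphism from a semisimple Lie algebra may be
replaced by one onto a representative of the linear equivalence class of its image. -/
lemma exists_hom_range_mem [IsKilling ℂ J] {R : Set (LieSubalgebra ℂ J)}
    (hR : IsSetOfRepresentatives R)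
    (hgen : ∀ M ∈ R, ∃ n : ℕ, Nonempty (CanonicalGenerators n M)) (f : S →ₗ⁅ℂ⁆ J) :
    ∃ α : S →ₗ⁅ℂ⁆ J, α.range ∈ R ∧ α.ker = f.ker ∧
      ∀ (V : Type u) [AddCommGroup V] [Module ℂ V] [FiniteDimensional ℂ V]
        (ρ : J →ₗ⁅ℂ⁆ Module.End ℂ V), RepIso (fun x ↦ ρ (f x)) (fun x ↦ ρ (α x)) := by
  have : IsKilling ℂ f.range := isKilling_of_surjective f.rangeRestrict f.surjective_rangeRestrict
  obtain ⟨M, ⟨hM, hlin⟩, -⟩ := hR.existsUnique f.range inferInstance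
  have := hR.semisimple M hM
  obtain ⟨n, ⟨G⟩⟩ := hgen M hM
  obtain ⟨φ, hφ⟩ := exists_equiv_repIso G.basis hlin
  let α : S →ₗ⁅ℂ⁆ J := M.incl.comp (φ.toLieHom.comp f.rangeRestrict)
  have hα : ∀ x, α x = φ (f.rangeRestrict x) := fun _ ↦ rfl
  refine ⟨α, ?_, ?_, fun V _ _ _ ρ ↦ ?_⟩
  · convert hM
    ext y
    refine ⟨?_, fun hy ↦ ?_⟩
    · rintro ⟨x, rfl⟩
      exact (φ (f.rangeRestrict x)).2
    · obtain ⟨x, hx⟩ := f.surjective_rangeRestrict (φ.symm ⟨y, hy⟩)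
      exact ⟨x, (hα x).trans (by rw [hx, LieEquiv.apply_symm_apply])⟩
  · ext x
    rw [LieHom.mem_ker, LieHom.mem_ker, hα]
    refine ⟨fun h ↦ ?_, fun h ↦ ?_⟩
    · have h1 : φ (f.rangeRestrict x) = φ 0 := by rw [map_zero]; exact Subtype.ext h
      exact congrArg Subtype.val (φ.injective h1)
    · have h1 : f.rangeRestrict x = 0 := Subtype.ext h
      rw [h1, map_zero]
      rfl
  · obtain ⟨A, hA⟩ := hφ V ρ
    exact ⟨A, fun x ↦ hA (f.rangeRestrict x)⟩

omit [FiniteDimensional ℂ J] [FiniteDimensional ℂ S] [IsKilling ℂ S] in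
/-- The image of a direct sum of ideals which is complementary to the kernel. -/
lemma isDirectSum_range (α : S →ₗ⁅ℂ⁆ J) {k k' : LieIdeal ℂ S} (hk : Disjoint k k')
    (h : IsCompl (k ⊔ k') α.ker) :
    IsDirectSum (α.comp k.incl).range (α.comp k'.incl).range α.range where
  sup_eq := by
    refine le_antisymm (sup_le ?_ ?_) ?_
    · rintro _ ⟨x, rfl⟩
      exact ⟨x, rfl⟩
    · rintro _ ⟨x, rfl⟩
      exact ⟨x, rfl⟩
    · rintro _ ⟨x, rfl⟩
      have hx : x ∈ k ⊔ k' ⊔ α.ker := by rw [h.sup_eq_top]; trivial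
      obtain ⟨y, hy, n, hn, rfl⟩ := (LieSubmodule.mem_sup _ _ _).mp hx
      obtain ⟨a, ha, b, hb, rfl⟩ := (LieSubmodule.mem_sup _ _ _).mp hy
      have hn' : α n = 0 := hn
      have e : α (a + b + n) = α a + α b := by rw [map_add, map_add, hn', add_zero]
      have h1 := Submodule.add_mem_sup (S := (α.comp k.incl).range.toSubmodule)
        (T := (α.comp k'.incl).range.toSubmodule) ⟨⟨a, ha⟩, rfl⟩ ⟨⟨b, hb⟩, rfl⟩
      exact Set.mem_of_eq_of_mem e h1
  disjoint := by
    rw [Submodule.disjoint_def]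
    rintro _ ⟨x, rfl⟩ ⟨y, hxy⟩
    have hxy' : α y = α x := hxy
    have h1 : (x : S) - y ∈ (k ⊔ k') ⊓ α.ker :=
      ⟨sub_mem ((le_sup_left : k ≤ k ⊔ k') x.2) ((le_sup_right : k' ≤ k ⊔ k') y.2),
        by change α ((x : S) - y) = 0; rw [map_sub, hxy', sub_self]⟩
    rw [h.inf_eq_bot, LieSubmodule.mem_bot, sub_eq_zero] at h1
    have h2 : (x : S) ∈ k ⊓ k' := ⟨x.2, h1 ▸ y.2⟩
    rw [hk.eq_bot, LieSubmodule.mem_bot] at h2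
    change α x = 0
    rw [h2, map_zero]
  lie_eq_zero := by
    rintro _ ⟨x, rfl⟩ _ ⟨y, rfl⟩
    change ⁅α x, α y⁆ = 0
    rw [← LieHom.map_lie, lie_eq_zero_of_disjoint hk x.2 y.2, map_zero]

end

variable {g : Type u} [LieRing g] [LieAlgebra ℂ g] [FiniteDimensional ℂ g] {I₁ I₂ : LieIdeal ℂ g}
  {H : LieSubalgebra ℂ g} {R₁ : Set (LieSubalgebra ℂ I₁)} {R₂ : Set (LieSubalgebra ℂ I₂)}

/-- A subalgebra of the direct sum of two ideals is linearly equivalent to one obtained by gluing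
the images of its projections. -/
lemma exists_linearlyEquivalent_glued [IsKilling ℂ I₁] [IsKilling ℂ I₂] (hI : Disjoint I₁ I₂)
    {P : GluablePair R₁ R₂} (d : GluingGenerators H P) (S : LieSubalgebra ℂ g) [IsKilling ℂ S]
    (f₁ α₁ : S →ₗ⁅ℂ⁆ I₁) (f₂ α₂ : S →ₗ⁅ℂ⁆ I₂) (hf : ∀ x : S, (x : g) = f₁ x + f₂ x)
    (h₁ : ∀ (V : Type u) [AddCommGroup V] [Module ℂ V] [FiniteDimensional ℂ V]
      (ρ : I₁ →ₗ⁅ℂ⁆ Module.End ℂ V), RepIso (fun x ↦ ρ (f₁ x)) (fun x ↦ ρ (α₁ x)))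
    (h₂ : ∀ (V : Type u) [AddCommGroup V] [Module ℂ V] [FiniteDimensional ℂ V]
      (ρ : I₂ →ₗ⁅ℂ⁆ Module.End ℂ V), RepIso (fun x ↦ ρ (f₂ x)) (fun x ↦ ρ (α₂ x)))
    {kb : LieIdeal ℂ S} (hb : IsCompl kb (α₂.ker ⊔ α₁.ker)) (hc : IsCompl α₁.ker (α₂.ker ⊔ kb))
    (ha : P.a = (α₁.comp α₂.ker.incl).range) (hc' : P.c = (α₂.comp α₁.ker.incl).range)
    (e₁ : kb ≃ₗ⁅ℂ⁆ P.b₁) (he₁ : ∀ x : kb, (e₁ x : I₁) = α₁ x)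
    (e₂ : kb ≃ₗ⁅ℂ⁆ P.b₂) (he₂ : ∀ x : kb, (e₂ x : I₂) = α₂ x) :
    ∃ π, d.PreservesCartanMatrix π ∧ LinearlyEquivalent S (d.glued π) := by
  obtain ⟨φ, hφ⟩ := d.sameOrder
  have : IsKilling ℂ kb := isKilling_lieIdeal kb
  have : IsKilling ℂ P.b₂ := isKilling_of_equiv e₂
  -- The deviation of `e₂ ∘ e₁⁻¹` from the prescribed `φ` is an automorphism of `b₂`; its
  -- permutation part supplies `π`.
  obtain ⟨π, q, δ, hq, hqδ, hδ⟩ :=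
    d.genB₂.basis.exists_isQuasiInner_mul_perm (φ.symm.trans (e₁.symm.trans e₂))
  have hqδ' : ∀ x, q.symm (e₂ x) = δ (φ (e₁ x)) := fun x ↦ by
    have := hqδ (φ (e₁ x))
    simp only [LieEquiv.trans_apply, LieEquiv.symm_apply_apply] at this
    rw [this, LieEquiv.symm_apply_apply]
  obtain ⟨pb, hpb, hpb', hpb''⟩ := exists_projection hb
  obtain ⟨pc, hpc, hpc', hpc''⟩ := exists_projection hc
  have hlie₂ : ∀ (x : kb) (y : α₁.ker), ⁅(δ (φ (e₁ x)) : I₂), α₂ y⁆ = 0 := fun x y ↦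
    P.decomp₂.lie_eq_zero _ (δ (φ (e₁ x))).2 _ (by rw [hc']; exact ⟨y, rfl⟩)
  -- `α₂` with its component on `kb` corrected by `q⁻¹`, which leaves there the `δ ∘ φ ∘ e₁` of the
  -- glued generators.
  let β : S →ₗ⁅ℂ⁆ I₂ := addOfCommute
    (P.b₂.incl.comp (δ.toLieHom.comp (φ.toLieHom.comp (e₁.toLieHom.comp pb))))
    (α₂.comp (α₁.ker.incl.comp pc)) (fun x y ↦ hlie₂ (pb x) (pc y))
  have hβ : ∀ x, β x = (δ (φ (e₁ (pb x))) : I₂) + α₂ (pc x) := fun _ ↦ rfl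
  let Ψ : S →ₗ⁅ℂ⁆ g := addOfCommute (I₁.incl.comp α₁) (I₂.incl.comp β)
    (fun x y ↦ lie_eq_zero_of_disjoint hI (α₁ x).2 (β y).2)
  have hΨ : ∀ x, Ψ x = (α₁ x : g) + (β x : g) := fun _ ↦ rfl
  have hΨa : ∀ x ∈ α₂.ker, Ψ x = α₁ x := fun x hx ↦ by
    rw [hΨ, hβ, hpb' x ((le_sup_left : α₂.ker ≤ _) hx), hpc' x ((le_sup_left : α₂.ker ≤ _) hx)]
    simp
  have hΨb : ∀ x : kb, Ψ x = (e₁ x : g) + (δ (φ (e₁ x)) : g) := fun x ↦ by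
    rw [hΨ, hβ, hpb, hpc' x ((le_sup_right : kb ≤ α₂.ker ⊔ kb) x.2), he₁]
    simp
  have hΨc : ∀ x ∈ α₁.ker, Ψ x = α₂ x := fun x hx ↦ by
    have h0 : α₁ x = 0 := hx
    have h1 : (pc x : S) = x := congrArg Subtype.val (hpc ⟨x, hx⟩)
    rw [hΨ, hβ, hpb' x ((le_sup_right : α₁.ker ≤ α₂.ker ⊔ α₁.ker) hx), h0, h1]
    simp
  have hmemA : ∀ y : P.a, (y : g) ∈ Ψ.range := fun y ↦ by
    have hy : (y : I₁) ∈ (α₁.comp α₂.ker.incl).range := ha ▸ y.2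
    obtain ⟨x, hx⟩ := hy
    exact ⟨x, (hΨa x x.2).trans (congrArg Subtype.val hx)⟩
  have hmemC : ∀ y : P.c, (y : g) ∈ Ψ.range := fun y ↦ by
    have hy : (y : I₂) ∈ (α₂.comp α₁.ker.incl).range := hc' ▸ y.2
    obtain ⟨x, hx⟩ := hy
    exact ⟨x, (hΨc x x.2).trans (congrArg Subtype.val hx)⟩
  have hmemB : ∀ y : P.b₁, (y : g) + (δ (φ y) : g) ∈ Ψ.range := fun y ↦
    ⟨e₁.symm y, (hΨb (e₁.symm y)).trans (by rw [LieEquiv.apply_symm_apply])⟩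
  let F : P.b₁ →ₗ⁅ℂ⁆ g := addOfCommute (I₁.incl.comp P.b₁.incl)
    (I₂.incl.comp (P.b₂.incl.comp (δ.toLieHom.comp φ.toLieHom)))
    (fun x y ↦ lie_eq_zero_of_disjoint hI (x : I₁).2 (δ (φ y) : I₂).2)
  have hF : ∀ y, F y = (y : g) + (δ (φ y) : g) := fun _ ↦ rfl
  have hgl : ∀ z, z ∈ ({z | ∃ i, z = (d.genA.h i : g) ∨ z = (d.genA.x i : g) ∨
      z = (d.genA.y i : g)} ∪
     {z | ∃ i, z = (d.genB₁.h i : g) + (d.genB₂.h (π i) : g) ∨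
               z = (d.genB₁.x i : g) + (d.genB₂.x (π i) : g) ∨
               z = (d.genB₁.y i : g) + (d.genB₂.y (π i) : g)} ∪
     {z | ∃ i, z = (d.genC.h i : g) ∨ z = (d.genC.x i : g) ∨ z = (d.genC.y i : g)}) →
     z ∈ d.glued π := fun z hz ↦ LieSubalgebra.subset_lieSpan hz
  have hA : ∀ y : P.a, (y : g) ∈ d.glued π :=
    d.genA.basis.map_mem (I₁.incl.comp P.a.incl) _
      (fun i ↦ hgl _ (Or.inl (Or.inl ⟨i, Or.inr (Or.inl rfl)⟩)))
      (fun i ↦ hgl _ (Or.inl (Or.inl ⟨i, Or.inr (Or.inr rfl)⟩)))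
  have hC : ∀ y : P.c, (y : g) ∈ d.glued π :=
    d.genC.basis.map_mem (I₂.incl.comp P.c.incl) _
      (fun i ↦ hgl _ (Or.inr ⟨i, Or.inr (Or.inl rfl)⟩))
      (fun i ↦ hgl _ (Or.inr ⟨i, Or.inr (Or.inr rfl)⟩))
  have hB : ∀ y : P.b₁, (y : g) + (δ (φ y) : g) ∈ d.glued π :=
    d.genB₁.basis.map_mem F _
      (fun i ↦ hgl _ (Or.inl (Or.inr ⟨i, Or.inr (Or.inl (by
        rw [hF, (hφ i).2.1, (hδ i).2.1]; rfl))⟩)))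
      (fun i ↦ hgl _ (Or.inl (Or.inr ⟨i, Or.inr (Or.inr (by
        rw [hF, (hφ i).2.2, (hδ i).2.2]; rfl))⟩)))
  have hrange : Ψ.range = d.glued π := by
    apply le_antisymm
    · rintro _ ⟨x, rfl⟩
      have hx : x ∈ kb ⊔ (α₂.ker ⊔ α₁.ker) := by rw [hb.sup_eq_top]; trivial
      obtain ⟨b, hb, y, hy, rfl⟩ := (LieSubmodule.mem_sup _ _ _).mp hx
      obtain ⟨a, ha', c, hc'', rfl⟩ := (LieSubmodule.mem_sup _ _ _).mp hy
      change Ψ _ ∈ _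
      rw [map_add, map_add, hΨa a ha', hΨc c hc'', hΨb ⟨b, hb⟩]
      exact add_mem (hB _) (add_mem (hA ⟨α₁ a, by rw [ha]; exact ⟨⟨a, ha'⟩, rfl⟩⟩)
        (hC ⟨α₂ c, by rw [hc']; exact ⟨⟨c, hc''⟩, rfl⟩⟩))
    · rw [GluingGenerators.glued, LieSubalgebra.lieSpan_le]
      rintro z ((⟨i, rfl | rfl | rfl⟩ | ⟨i, rfl | rfl | rfl⟩) | ⟨i, rfl | rfl | rfl⟩)
      · exact hmemA (d.genA.basis.h i)
      · exact hmemA (d.genA.basis.e i)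
      · exact hmemA (d.genA.basis.f i)
      · have := hmemB (d.genB₁.basis.h i)
        rwa [(hφ i).1, (hδ i).1] at this
      · have := hmemB (d.genB₁.basis.e i)
        rwa [(hφ i).2.1, (hδ i).2.1] at this
      · have := hmemB (d.genB₁.basis.f i)
        rwa [(hφ i).2.2, (hδ i).2.2] at this
      · exact hmemC (d.genC.basis.h i)
      · exact hmemC (d.genC.basis.e i)
      · exact hmemC (d.genC.basis.f i)
  refine ⟨π, d.genB₂.basis.cartanMatrix_perm fun i ↦ ⟨(hδ i).1, (hδ i).2.1⟩, ?_⟩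
  rw [← hrange]
  refine linearlyEquivalent_range S Ψ fun V _ _ _ ρ ↦ ?_
  have r1 := repIso_add hI f₁ α₁ f₂ α₂ h₁ h₂ V ρ
  -- The other components centralize `b₂`, so no representation detects the correction by `q⁻¹`.
  have r2 := hq.symm.repIso (I₂.incl.comp P.b₂.incl) (fun x : S ↦ e₂ (pb x))
    (fun x : S ↦ (α₁ x : g) + (α₂ (pc x) : g)) (fun x y ↦ by
      have e1 : ⁅(α₁ x : g), ((y : I₂) : g)⁆ = 0 :=
        lie_eq_zero_of_disjoint hI (α₁ x).2 (y : I₂).2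
      have e2 : ⁅α₂ (pc x), (y : I₂)⁆ = 0 := by
        rw [← lie_skew, P.decomp₂.lie_eq_zero _ y.2 _ (by rw [hc']; exact ⟨pc x, rfl⟩), neg_zero]
      have e3 : ⁅(α₂ (pc x) : g), ((y : I₂) : g)⁆ = 0 := congrArg Subtype.val e2
      change ⁅(α₁ x : g) + (α₂ (pc x) : g), ((y : I₂) : g)⁆ = 0
      rw [add_lie, e1, e3, add_zero]) V ρ
  have hα₂ : ∀ x : S, α₂ x = (e₂ (pb x) : I₂) + α₂ (pc x) := fun x ↦ by
    have hx1 : x - pb x - pc x ∈ α₂.ker := by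
      obtain ⟨a, ha', c, hc'', e⟩ := (LieSubmodule.mem_sup _ _ _).mp (hpb'' x)
      have h1 : pc x = ⟨c, hc''⟩ := by
        have h2 : x = pb x + (a + c) := by rw [e]; abel
        rw [h2, map_add, map_add, hpc' _ ((le_sup_right : kb ≤ α₂.ker ⊔ kb) (pb x).2),
          hpc' a ((le_sup_left : α₂.ker ≤ _) ha'), zero_add, zero_add]
        exact hpc ⟨c, hc''⟩
      rw [h1, ← e]
      simpa using ha'
    rw [he₂, ← map_add, ← sub_eq_zero, ← map_sub, ← sub_sub]
    exact hx1
  have r3 : (fun x : S ↦ ρ x) = fun x ↦ ρ ((f₁ x : g) + (f₂ x : g)) := funext fun x ↦ by rw [hf x]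
  rw [r3]
  refine r1.trans ?_
  have r4 : (fun x : S ↦ ρ ((α₁ x : g) + (α₂ x : g))) = fun x ↦
      ρ ((α₁ x : g) + (α₂ (pc x) : g) + (I₂.incl.comp P.b₂.incl) (e₂ (pb x))) := funext fun x ↦ by
    congr 1
    rw [hα₂ x]
    change (α₁ x : g) + (((e₂ (pb x) : I₂) : g) + (α₂ (pc x) : g)) =
      (α₁ x : g) + (α₂ (pc x) : g) + ((e₂ (pb x) : I₂) : g)
    abel
  have r5 : (fun x : S ↦ ρ (Ψ x)) = fun x ↦
      ρ ((α₁ x : g) + (α₂ (pc x) : g) + (I₂.incl.comp P.b₂.incl) (q.symm (e₂ (pb x)))) :=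
    funext fun x ↦ by
      congr 1
      rw [hΨ, hβ, hqδ']
      change (α₁ x : g) + (((δ (φ (e₁ (pb x))) : I₂) : g) + (α₂ (pc x) : g)) =
        (α₁ x : g) + (α₂ (pc x) : g) + ((δ (φ (e₁ (pb x))) : I₂) : g)
      abel
  rw [r4, r5]
  exact r2

end SemisimpleSubalgebras

/-! ### Decomposition of `S` by the two kernels. -/

theorem mainTheorem3 {g : Type u} [LieRing g] [LieAlgebra ℂ g] [FiniteDimensional ℂ g]
    (I₁ I₂ : LieIdeal ℂ g)
    (hI₁ : LieAlgebra.IsSemisimple ℂ I₁) (hI₂ : LieAlgebra.IsSemisimple ℂ I₂)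
    (hI : IsCompl I₁ I₂)
    (H : LieSubalgebra ℂ g) (hH : H.IsCartanSubalgebra)
    (L₁ : Set (LieSubalgebra ℂ I₁)) (L₂ : Set (LieSubalgebra ℂ I₂))
    (hL₁ : SemisimpleSubalgebras.IsSetOfRepresentatives L₁)
    (hL₂ : SemisimpleSubalgebras.IsSetOfRepresentatives L₂)
    (hgen₁ : ∀ M ∈ L₁, ∃ (n : ℕ) (G : SemisimpleSubalgebras.CanonicalGenerators n M),
      SemisimpleSubalgebras.HPartIn H G)
    (hgen₂ : ∀ M ∈ L₂, ∃ (n : ℕ) (G : SemisimpleSubalgebras.CanonicalGenerators n M),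
      SemisimpleSubalgebras.HPartIn H G)
    (D : ∀ P : SemisimpleSubalgebras.GluablePair L₁ L₂,
      SemisimpleSubalgebras.GluingGenerators H P)
    (S : LieSubalgebra ℂ g) (hS : LieAlgebra.IsSemisimple ℂ S) :
    ∃ T ∈ SemisimpleSubalgebras.constructedSubalgebras D,
      SemisimpleSubalgebras.LinearlyEquivalent S T := by
  obtain ⟨p₁, hp₁, hp₁', hp₁''⟩ := LieAlgebra.exists_projection hI
  obtain ⟨p₂, hp₂, hp₂', -⟩ := LieAlgebra.exists_projection hI.symm
  let f₁ : S →ₗ⁅ℂ⁆ I₁ := p₁.comp S.incl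
  let f₂ : S →ₗ⁅ℂ⁆ I₂ := p₂.comp S.incl
  have hf : ∀ x : S, (x : g) = f₁ x + f₂ x := fun x ↦ by
    have h1 : p₂ ((x : g) - p₁ x) = ⟨(x : g) - p₁ x, hp₁'' x⟩ := hp₂ ⟨_, hp₁'' x⟩
    rw [map_sub, hp₂' _ (p₁ x).2, sub_zero] at h1
    change (x : g) = (p₁ x : g) + (p₂ x : g)
    rw [h1]
    exact (add_sub_cancel _ _).symm
  obtain ⟨α₁, hα₁, hk₁, hr₁⟩ := SemisimpleSubalgebras.exists_hom_range_mem hL₁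
    (fun M hM ↦ (hgen₁ M hM).imp fun _ h ↦ h.nonempty) f₁
  obtain ⟨α₂, hα₂, hk₂, hr₂⟩ := SemisimpleSubalgebras.exists_hom_range_mem hL₂
    (fun M hM ↦ (hgen₂ M hM).imp fun _ h ↦ h.nonempty) f₂
  have hdisj : Disjoint α₂.ker α₁.ker := by
    rw [disjoint_iff, LieSubmodule.eq_bot_iff]
    intro x hx
    rw [hk₁, hk₂] at hx
    have e1 : f₁ x = 0 := hx.2
    have e2 : f₂ x = 0 := hx.1
    refine Subtype.ext ((hf x).trans ?_)
    rw [e1, e2]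
    simp
  -- The kernels are disjoint because `f₁` and `f₂` jointly determine an element. Hence `S = ker α₂
  -- ⊕ kb ⊕ ker α₁`, where `α₁` is injective on the first two summands and `α₂` on the last two.
  let kb : LieIdeal ℂ S := (α₂.ker ⊔ α₁.ker).killingCompl
  have hb : IsCompl (α₂.ker ⊔ α₁.ker) kb := LieIdeal.isCompl_killingCompl _
  have hac : IsCompl (α₂.ker ⊔ kb) α₁.ker :=
    ⟨(Disjoint.disjoint_sup_right_of_disjoint_sup_left hdisj.symm
      (by rw [sup_comm]; exact hb.disjoint)).symm, by
      rw [codisjoint_iff, sup_right_comm]; exact hb.sup_eq_top⟩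
  have hca : IsCompl (kb ⊔ α₁.ker) α₂.ker :=
    ⟨(by
      rw [sup_comm]
      exact (Disjoint.disjoint_sup_right_of_disjoint_sup_left hdisj hb.disjoint).symm), by
      rw [codisjoint_iff, ← hb.sup_eq_top]; ac_rfl⟩
  have hinj₁ : Function.Injective (α₁.comp kb.incl) := by
    rw [injective_iff_map_eq_zero]
    intro x hx
    have h1 : (x : S) ∈ α₁.ker ⊓ kb := ⟨hx, x.2⟩
    rw [(hb.disjoint.mono_left le_sup_right).eq_bot, LieSubmodule.mem_bot] at h1
    exact Subtype.ext h1
  have hinj₂ : Function.Injective (α₂.comp kb.incl) := by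
    rw [injective_iff_map_eq_zero]
    intro x hx
    have h1 : (x : S) ∈ α₂.ker ⊓ kb := ⟨hx, x.2⟩
    rw [(hb.disjoint.mono_left le_sup_left).eq_bot, LieSubmodule.mem_bot] at h1
    exact Subtype.ext h1
  let e₁ := LieEquiv.ofInjective _ hinj₁
  let e₂ := LieEquiv.ofInjective _ hinj₂
  let P : SemisimpleSubalgebras.GluablePair L₁ L₂ :=
    { M₁ := α₁.range
      M₂ := α₂.range
      mem₁ := hα₁
      mem₂ := hα₂
      a := (α₁.comp α₂.ker.incl).range
      b₁ := (α₁.comp kb.incl).range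
      b₂ := (α₂.comp kb.incl).range
      c := (α₂.comp α₁.ker.incl).range
      decomp₁ := SemisimpleSubalgebras.isDirectSum_range α₁
        (hb.disjoint.mono_left le_sup_left) hac
      decomp₂ := SemisimpleSubalgebras.isDirectSum_range α₂
        (hb.disjoint.mono_left le_sup_right).symm hca
      iso := ⟨e₁.symm.trans e₂⟩ }
  obtain ⟨π, hπ, h⟩ := SemisimpleSubalgebras.exists_linearlyEquivalent_glued hI.disjoint (D P) S
    f₁ α₁ f₂ α₂ hf hr₁ hr₂ hb.symm hac.symm rfl rfl e₁ (fun _ ↦ rfl) e₂ (fun _ ↦ rfl)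
  exact ⟨_, ⟨P, π, hπ, rfl⟩, h⟩
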